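/- Let $(E,\mathcal E)$ be a Borel (standard Borel) space, $\alpha$ a finite measure on $E$ and $p\in(0,1)$. Let $\mathbf N_{<\infty}$ be the space of finite counting measures on $E$ (measures $\eta$ with $\eta(B)\in\mathbb N_0$ for all $B\in\mathcal E$), with the $\sigma$-algebra generated by the maps $\eta\mapsto\eta(B)$, $B\in\mathcal E$. Let $\rho_{p,\alpha}$ be the law of the Pascal point process, that is, the unique probability measure on $\mathbf N_{<\infty}$ such that $$\rho_{p,\alpha}(\{\eta:\eta(B)=n\})=(1-p)^{\alpha(B)}\frac{p^n}{n!}\,\alpha(B)(\alpha(B)+1)\cdots(\alpha(B)+n-1)$$ for all $B\in\mathcal E$, $n\in\mathbb N_0$, and such that $\eta(B_1),\dots,\eta(B_n)$ are independent under $\rho_{p,\alpha}$ for all $n\ge 2$ and pairwise disjoint $B_1,\dots,B_n\in\mathcal E$. Let $\mathcal H=L^2(\mathbf N_{<\infty},\rho_{p,\alpha};\mathbb C)$, and let $\mathcal D\subset\mathcal H$ be the set of (classes of) bounded measurable functions $F$ for which there is $m\in\mathbb N$ such that $F$ vanishes outside $\{\eta:\eta(E)\le m\}$. Define $k^{\pm}(\mathbf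 1):\mathcal D\to\mathcal D$ by $$k^+(\mathbf 1)F(\eta)=\frac1{\sqrt p}\int F(\eta-\delta_x)\,\eta(\mathrm dx),\qquad k^-(\mathbf 1)F(\eta)=\sqrt p\int F(\eta+\delta_x)\,(\alpha+\eta)(\mathrm dx).$$ Then, for every $\xi\in\mathbb C$, the operator $A=\frac1{\mathrm i}\bigl(\xi k^+(\mathbf 1)-\overline{\xi}\,k^-(\mathbf 1)\bigr)$ in $\mathcal H$ with domain $\mathcal D$ is closable, and its closure is self-adjoint. Moreover, every $f\in\mathcal D$ is an analytic vector for $A$: there is $\varepsilon>0$ with $\sum_{n=0}^\infty\frac{\varepsilon^n}{n!}\|A^nf\|<\infty$. -/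

import Mathlib

open MeasureTheory ProbabilityTheory
open scoped ENNReal ComplexConjugate

noncomputable section

namespace Pascal

/-- A finite counting measure on `E`: a measure all of whose values on measurable sets are
nonnegative integers (in particular the total mass is finite). -/
structure Config (E : Type*) [MeasurableSpace E] where
  toMeasure : Measure E
  counting : ∀ B, MeasurableSet B → ∃ n : ℕ, toMeasure B = n

variable {E : Type*} [MeasurableSpace E]

/-- The σ-algebra generated by the counting variables `η ↦ η(B)`, `B` measurable. -/
instance : MeasurableSpace (Config E) :=
  ⨆ B : {B : Set E // MeasurableSet B},
    MeasurableSpace.comap (fun η : Config E => η.toMeasure B) inferInstance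

namespace Config

@[ext]
theorem ext {η ζ : Config E} (h : η.toMeasure = ζ.toMeasure) : η = ζ := by
  cases η; cases ζ; simpa using h

/-- The empty configuration. -/
instance : Zero (Config E) := ⟨⟨0, fun _ _ => ⟨0, by simp⟩⟩⟩

@[simp] theorem toMeasure_zero : (0 : Config E).toMeasure = 0 := rfl

/-- The configuration `η + δ_x`. -/
def add (η : Config E) (x : E) : Config E :=
  ⟨η.toMeasure + Measure.dirac x, fun B hB => by
    obtain ⟨n, hn⟩ := η.counting B hB
    by_cases hx : x ∈ B
    · exact ⟨n + 1, by simp [hn, Measure.dirac_apply' x hB, hx]⟩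
    · exact ⟨n, by simp [hn, Measure.dirac_apply' x hB, hx]⟩⟩

@[simp] theorem toMeasure_add (η : Config E) (x : E) :
    (η.add x).toMeasure = η.toMeasure + Measure.dirac x := rfl

open Classical in
/-- The configuration `η - δ_x`, for `x` a point of `η`. (If `η - δ_x` is not a counting
measure, the value is `η`; this does not happen for `η`-almost every `x`.) -/
def remove (η : Config E) (x : E) : Config E :=
  if h : ∀ B, MeasurableSet B → ∃ n : ℕ, (η.toMeasure - Measure.dirac x) B = n
  then ⟨η.toMeasure - Measure.dirac x, h⟩ else η

instance (η : Config E) : IsFiniteMeasure η.toMeasure :=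
  ⟨by obtain ⟨n, hn⟩ := η.counting Set.univ MeasurableSet.univ; simp [hn]⟩

theorem remove_add (η : Config E) (x : E) : (η.add x).remove x = η := by
  have h : (η.add x).toMeasure - Measure.dirac x = η.toMeasure := by
    simp
  ext1
  rw [remove, dif_pos (by rw [h]; exact η.counting)]
  exact h

theorem measurable_eval {B : Set E} (hB : MeasurableSet B) :
    Measurable (fun η : Config E => η.toMeasure B) :=
  Measurable.of_comap_le
    (le_iSup (fun B : {B : Set E // MeasurableSet B} =>
      MeasurableSpace.comap (fun η : Config E => η.toMeasure B) inferInstance) ⟨B, hB⟩)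

theorem measurable_toMeasure : Measurable (toMeasure : Config E → Measure E) :=
  Measure.measurable_of_measurable_coe _ fun _ hB => measurable_eval hB

theorem measurable_of_eval {X : Type*} [MeasurableSpace X] {f : X → Config E}
    (h : ∀ B, MeasurableSet B → Measurable fun a => (f a).toMeasure B) : Measurable f := by
  refine Measurable.of_le_map (iSup_le fun B => ?_)
  rw [← MeasurableSpace.comap_le_iff_le_map, MeasurableSpace.comap_comp]
  exact (h B B.2).comap_le

theorem measurable_add : Measurable fun q : Config E × E => q.1.add q.2 := by
  refine measurable_of_eval fun B hB => ?_
  simp only [toMeasure_add, Measure.coe_add, Pi.add_apply, Measure.dirac_apply' _ hB]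
  exact ((measurable_eval hB).comp measurable_fst).add
    ((measurable_one.indicator hB).comp measurable_snd)

/-- The kernel `η ↦ η(dx)`. -/
def kernel (E : Type*) [MeasurableSpace E] : Kernel (Config E) E :=
  ⟨toMeasure, measurable_toMeasure⟩

@[simp] theorem kernel_apply (η : Config E) : kernel E η = η.toMeasure := rfl

theorem measurableSet_eval_eq {B : Set E} (hB : MeasurableSet B) (c : ℝ≥0∞) :
    MeasurableSet {η : Config E | η.toMeasure B = c} :=
  measurable_eval hB (measurableSet_singleton c)

open Classical in
instance : IsSFiniteKernel (kernel E) := by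
  let κ : ℕ → Kernel (Config E) E := fun n =>
    Kernel.piecewise (measurableSet_eval_eq (E := E) MeasurableSet.univ (n : ℝ≥0∞)) (kernel E) 0
  refine ⟨κ, fun n => ⟨⟨n, by simp, fun η => ?_⟩⟩, ?_⟩
  · simp only [κ, Kernel.piecewise_apply]
    split_ifs with h
    · exact le_of_eq h
    · simp
  · ext η B hB
    obtain ⟨n, hn⟩ := η.counting Set.univ MeasurableSet.univ
    rw [Kernel.sum_apply' _ _ hB, tsum_eq_single n]
    · simp [κ, Kernel.piecewise_apply, hn]
    · intro m hm
      have : ¬ (n : ℝ≥0∞) = m := by exact_mod_cast hm.symm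
      simp [κ, Kernel.piecewise_apply, hn, this]

/-- The number of points of `η` in `B`, as a natural number. -/
def cnt (B : Set E) (η : Config E) : ℕ := ⌊(η.toMeasure B).toReal⌋₊

theorem cast_cnt {B : Set E} (hB : MeasurableSet B) (η : Config E) :
    (cnt B η : ℝ≥0∞) = η.toMeasure B := by
  obtain ⟨n, hn⟩ := η.counting B hB
  simp [cnt, hn]

theorem cnt_eq_iff {B : Set E} (hB : MeasurableSet B) (η : Config E) (n : ℕ) :
    cnt B η = n ↔ η.toMeasure B = n := by
  rw [← cast_cnt hB]; exact_mod_cast Iff.rfl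

theorem measurable_cnt {B : Set E} (hB : MeasurableSet B) :
    Measurable (cnt B : Config E → ℕ) :=
  Nat.measurable_floor.comp (measurable_eval hB).ennreal_toReal

/-- A nonzero counting measure on a standard Borel space has an atom. -/
theorem exists_atom [StandardBorelSpace E] (η : Config E) {B : Set E} (hB : MeasurableSet B)
    (h : η.toMeasure B ≠ 0) : ∃ x ∈ B, η.toMeasure {x} ≠ 0 := by
  classical
  have hex : ∃ n : ℕ, n ≠ 0 ∧ ∃ C ⊆ B, MeasurableSet C ∧ η.toMeasure C = n := by
    obtain ⟨n, hn⟩ := η.counting B hB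
    exact ⟨n, by rintro rfl; simp [hn] at h, B, subset_rfl, hB, hn⟩
  obtain ⟨hn0, C, hCB, hC, hCn⟩ := Nat.find_spec hex
  set n := Nat.find hex
  have key : ∀ U, MeasurableSet U → U ∈ ae (η.toMeasure.restrict C) ∨
      Uᶜ ∈ ae (η.toMeasure.restrict C) := by
    intro U hU
    by_contra! hcon
    simp only [mem_ae_iff, compl_compl, Measure.restrict_apply hU,
      Measure.restrict_apply hU.compl] at hcon
    obtain ⟨a, ha⟩ := η.counting (U ∩ C) (hU.inter hC)
    obtain ⟨b, hb⟩ := η.counting (Uᶜ ∩ C) (hU.compl.inter hC)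
    have ha0 : a ≠ 0 := by rintro rfl; exact hcon.2 (by simpa using ha)
    have hb0 : b ≠ 0 := by rintro rfl; exact hcon.1 (by simpa using hb)
    have h1 : n ≤ a := Nat.find_min' hex
      ⟨ha0, U ∩ C, Set.inter_subset_right.trans hCB, hU.inter hC, ha⟩
    have h2 : a + b = n := by
      have := measure_inter_add_sdiff (μ := η.toMeasure) C hU
      rw [Set.inter_comm, ha, hCn, Set.sdiff_eq, Set.inter_comm, hb] at this
      exact_mod_cast this
    omega
  have hne : C.Nonempty := by
    rw [Set.nonempty_iff_ne_empty]
    rintro rfl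
    rw [measure_empty] at hCn
    exact hn0 (by exact_mod_cast hCn.symm)
  have hCmem : C ∈ ae (η.toMeasure.restrict C) := ae_restrict_mem hC
  obtain ⟨x, hxC, hx⟩ := Filter.exists_mem_singleton_mem_of_mem_of_nonempty_of_forall_separating
    MeasurableSet hCmem hne key
  refine ⟨x, hCB hxC, fun h0 => hn0 ?_⟩
  have hx' : η.toMeasure ({x}ᶜ ∩ C) = 0 := by
    rwa [mem_ae_iff, Measure.restrict_apply (measurableSet_singleton x).compl] at hx
  have : η.toMeasure C ≤ η.toMeasure {x} + η.toMeasure ({x}ᶜ ∩ C) :=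
    (measure_mono fun y hy => by
      by_cases hyx : y = x
      · exact Or.inl hyx
      · exact Or.inr ⟨hyx, hy⟩).trans (measure_union_le _ _)
  rw [h0, hx', hCn] at this
  simpa using this

theorem measurable_mass [StandardBorelSpace E] :
    Measurable fun q : Config E × E => q.1.toMeasure {q.2} := by
  have hd : MeasurableSet {r : (Config E × E) × E | r.2 = r.1.2} :=
    measurableSet_eq_fun measurable_snd (measurable_snd.comp measurable_fst)
  exact Kernel.measurable_kernel_prodMk_left (κ := Kernel.prodMkRight E (kernel E)) hd

theorem ae_mass_ne_zero [StandardBorelSpace E] (η : Config E) :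
    ∀ᵐ x ∂η.toMeasure, η.toMeasure {x} ≠ 0 := by
  have hm : MeasurableSet {x | η.toMeasure {x} = 0} :=
    (measurable_mass.comp (measurable_prodMk_left (x := η))) (measurableSet_singleton 0)
  rw [ae_iff]
  by_contra h
  obtain ⟨x, hx, hx'⟩ := exists_atom η (B := {x | η.toMeasure {x} = 0}) hm (by simpa using h)
  exact hx' hx

theorem dirac_le {η : Config E} [MeasurableSingletonClass E] {x : E}
    (hx : η.toMeasure {x} ≠ 0) : Measure.dirac x ≤ η.toMeasure := by
  obtain ⟨n, hn⟩ := η.counting {x} (measurableSet_singleton x)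
  have h1 : 1 ≤ η.toMeasure {x} := by
    rw [hn] at hx ⊢
    exact_mod_cast Nat.one_le_iff_ne_zero.2 (by exact_mod_cast hx)
  refine Measure.le_iff.2 fun B hB => ?_
  rw [Measure.dirac_apply' x hB]
  by_cases hxB : x ∈ B
  · simpa [hxB] using h1.trans (measure_mono (Set.singleton_subset_iff.2 hxB))
  · simp [hxB]

/-- At an atom `x` of `η`, the configuration `η.remove x` is the measure `η - δ_x`. -/
theorem toMeasure_remove [MeasurableSingletonClass E] {η : Config E} {x : E}
    (hx : η.toMeasure {x} ≠ 0) : (η.remove x).toMeasure = η.toMeasure - Measure.dirac x := by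
  rw [remove, dif_pos]
  intro B hB
  obtain ⟨n, hn⟩ := η.counting B hB
  rw [Measure.sub_apply hB (dirac_le hx), hn, Measure.dirac_apply' x hB]
  by_cases hxB : x ∈ B
  · exact ⟨n - 1, by simp [hxB]⟩
  · exact ⟨n, by simp [hxB]⟩

theorem add_remove [MeasurableSingletonClass E] {η : Config E} {x : E}
    (hx : η.toMeasure {x} ≠ 0) : (η.remove x).add x = η := by
  ext1
  rw [toMeasure_add, toMeasure_remove hx, Measure.sub_add_cancel_of_le (dirac_le hx)]

open Classical in
theorem measurable_remove [StandardBorelSpace E] :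
    Measurable fun q : Config E × E =>
      if q.1.toMeasure {q.2} = 0 then (0 : Config E) else q.1.remove q.2 := by
  refine measurable_of_eval fun B hB => ?_
  have : (fun q : Config E × E =>
      (if q.1.toMeasure {q.2} = 0 then (0 : Config E) else q.1.remove q.2).toMeasure B) =
      fun q : Config E × E => if q.1.toMeasure {q.2} = 0 then 0 else
        q.1.toMeasure B - B.indicator 1 q.2 := by
    ext q
    split_ifs with h
    · simp
    · rw [toMeasure_remove h, Measure.sub_apply hB (dirac_le h), Measure.dirac_apply' _ hB]
  rw [this]
  refine Measurable.ite (measurable_mass (measurableSet_singleton 0)) measurable_const ?_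
  exact ((measurable_eval hB).comp measurable_fst).sub
    ((measurable_one.indicator hB).comp measurable_snd)

end Config

/-! ### The Pascal point process -/

/-- `ρ` is the law of the Pascal point process with parameters `p` and `α`: the number of points
in `B` has the negative binomial law
`ρ(η(B) = n) = (1 - p) ^ α(B) * p ^ n / n! * α(B) (α(B) + 1) ⋯ (α(B) + n - 1)`,
and the numbers of points in finitely many pairwise disjoint sets are independent. -/
structure IsPascalLaw (p : ℝ) (α : Measure E) (ρ : Measure (Config E)) : Prop where
  isProbabilityMeasure : IsProbabilityMeasure ρ
  count : ∀ B : Set E, MeasurableSet B → ∀ n : ℕ,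
    ρ {η | η.toMeasure B = n} = ENNReal.ofReal
      ((1 - p) ^ (α.real B) * (p ^ n / n.factorial) * (ascPochhammer ℝ n).eval (α.real B))
  indep : ∀ n : ℕ, 2 ≤ n → ∀ B : Fin n → Set E, (∀ i, MeasurableSet (B i)) →
    Pairwise (Function.onFun Disjoint B) →
    iIndepFun (fun i (η : Config E) => η.toMeasure (B i)) ρ

/-- The transition kernel that adds to `η` a point with law proportional to `α + η`
(without normalisation). -/
def urnKernel (α : Measure E) [IsFiniteMeasure α] : Kernel (Config E) (Config E) :=
  (Kernel.id ×ₖ (Kernel.const _ α + Config.kernel E)).map fun q => q.1.add q.2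

/-- The unnormalised law of `n` points added one after the other to the empty configuration. -/
def urn (α : Measure E) [IsFiniteMeasure α] : ℕ → Measure (Config E)
  | 0 => Measure.dirac 0
  | n + 1 => (urn α n).bind (urnKernel α)

section Mecke

variable (α : Measure E) [IsFiniteMeasure α]

theorem measurable_lintegral_kernel {f : Config E × E → ℝ≥0∞} (hf : Measurable f) :
    Measurable fun η : Config E => ∫⁻ x, f (η, x) ∂η.toMeasure :=
  hf.lintegral_kernel_prod_right' (κ := Config.kernel E)

theorem measurable_lintegral_add {f : Config E × E → ℝ≥0∞} (hf : Measurable f) :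
    Measurable fun η : Config E => ∫⁻ x, f (η, x) ∂(α + η.toMeasure) :=
  hf.lintegral_kernel_prod_right' (κ := Kernel.const _ α + Config.kernel E)

theorem lintegral_urn_succ (n : ℕ) {G : Config E → ℝ≥0∞} (hG : Measurable G) :
    ∫⁻ η, G η ∂urn α (n + 1) = ∫⁻ η, ∫⁻ x, G (η.add x) ∂(α + η.toMeasure) ∂urn α n := by
  rw [urn, Measure.lintegral_bind (Kernel.aemeasurable _) hG.aemeasurable]
  refine lintegral_congr fun η => ?_
  rw [urnKernel, Kernel.lintegral_map _ Config.measurable_add _ hG,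
    Kernel.lintegral_id_prod (f := fun q : Config E × E => G (q.1.add q.2)) (hG.comp Config.measurable_add)]
  simp

theorem swap_aux (μ : Measure E) [IsFiniteMeasure μ] {f : E × E → ℝ≥0∞} (hf : Measurable f) :
    ∫⁻ x, ∫⁻ y, f (x, y) ∂(μ + Measure.dirac x) ∂μ =
      ∫⁻ y, ∫⁻ x, f (x, y) ∂(μ + Measure.dirac y) ∂μ := by
  have h1 : ∀ x, ∫⁻ y, f (x, y) ∂(μ + Measure.dirac x) = ∫⁻ y, f (x, y) ∂μ + f (x, x) := by
    intro x
    rw [lintegral_add_measure,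
      lintegral_dirac' x (f := fun y => f (x, y)) (hf.comp measurable_prodMk_left)]
  have h2 : ∀ y, ∫⁻ x, f (x, y) ∂(μ + Measure.dirac y) = ∫⁻ x, f (x, y) ∂μ + f (y, y) := by
    intro x
    rw [lintegral_add_measure,
      lintegral_dirac' x (f := fun y => f (y, x)) (hf.comp measurable_prodMk_right)]
  simp_rw [h1, h2]
  rw [lintegral_add_left hf.lintegral_prod_right', lintegral_add_left hf.lintegral_prod_left',
    lintegral_lintegral_swap (f := fun x y => f (x, y)) hf.aemeasurable]

theorem Config.add_comm (η : Config E) (x y : E) : (η.add x).add y = (η.add y).add x := by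
  ext1; simp [add_assoc, _root_.add_comm (Measure.dirac x)]

theorem mecke_urn (n : ℕ) {F : Config E × E → ℝ≥0∞} (hF : Measurable F) :
    ∫⁻ η, ∫⁻ x, F (η, x) ∂η.toMeasure ∂urn α (n + 1) =
      (n + 1) * ∫⁻ η, ∫⁻ x, F (η.add x, x) ∂(α + η.toMeasure) ∂urn α n := by
  have hF1 : Measurable fun q : Config E × E => F (q.1.add q.2, q.2) :=
    hF.comp (Config.measurable_add.prodMk measurable_snd)
  induction n generalizing F with
  | zero =>
    rw [lintegral_urn_succ α 0 (measurable_lintegral_kernel hF)]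
    simp only [urn, CharP.cast_eq_zero, zero_add, one_mul]
    rw [lintegral_dirac' _ (measurable_lintegral_add α hF1), lintegral_dirac']
    · refine lintegral_congr fun x => ?_
      simp only [Config.toMeasure_add, Config.toMeasure_zero, zero_add]
      rw [lintegral_dirac' x (f := fun y => F (Config.add 0 x, y)) (hF.comp measurable_prodMk_left)]
    · exact measurable_lintegral_add α
        (f := fun q => ∫⁻ x, F (q.1.add q.2, x) ∂(q.1.add q.2).toMeasure)
        ((measurable_lintegral_kernel hF).comp Config.measurable_add)
  | succ n ih =>
    have hF2 : Measurable fun r : (Config E × E) × E => F (r.1.1.add r.2, r.1.2) :=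
      hF.comp ((Config.measurable_add.comp
        ((measurable_fst.comp measurable_fst).prodMk measurable_snd)).prodMk
        (measurable_snd.comp measurable_fst))
    have hF' : Measurable fun q : Config E × E =>
        ∫⁻ y, F (q.1.add y, q.2) ∂(α + q.1.toMeasure) :=
      hF2.lintegral_kernel_prod_right'
        (κ := Kernel.prodMkRight E (Kernel.const (Config E) α + Config.kernel E))
    have hin : ∀ η : Config E, Measurable fun q : E × E => F (η.add q.1, q.2) := fun η =>
      hF.comp ((Config.measurable_add.comp (measurable_const.prodMk measurable_fst)).prodMk
        measurable_snd)
    rw [lintegral_urn_succ α (n + 1) (measurable_lintegral_kernel hF)]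
    have h1 : ∀ η : Config E,
        ∫⁻ y, ∫⁻ x, F (η.add y, x) ∂(η.add y).toMeasure ∂(α + η.toMeasure) =
        ∫⁻ y, F (η.add y, y) ∂(α + η.toMeasure) +
          ∫⁻ x, ∫⁻ y, F (η.add y, x) ∂(α + η.toMeasure) ∂η.toMeasure := by
      intro η
      have hd : Measurable fun y => F (η.add y, y) := hF1.comp measurable_prodMk_left
      rw [lintegral_lintegral_swap (f := fun x y => F (η.add y, x))
        ((hin η).comp measurable_swap).aemeasurable, ← lintegral_add_left hd]
      refine lintegral_congr fun y => ?_
      rw [Config.toMeasure_add, lintegral_add_measure, _root_.add_comm,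
        lintegral_dirac' y (f := fun x => F (η.add y, x)) (hF.comp measurable_prodMk_left)]
    have hF1' : Measurable fun q : Config E × E =>
        ∫⁻ y, F ((q.1.add q.2).add y, q.2) ∂(α + (q.1.add q.2).toMeasure) :=
      hF'.comp (Config.measurable_add.prodMk measurable_snd)
    simp_rw [h1]
    rw [lintegral_add_left (measurable_lintegral_add α hF1), ih hF' hF1',
      lintegral_urn_succ α n (measurable_lintegral_add α hF1)]
    have h2 : ∀ η : Config E,
        ∫⁻ x, ∫⁻ y, F ((η.add x).add y, x) ∂(α + (η.add x).toMeasure) ∂(α + η.toMeasure) =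
        ∫⁻ y, ∫⁻ x, F ((η.add y).add x, x) ∂(α + (η.add y).toMeasure) ∂(α + η.toMeasure) := by
      intro η
      have := swap_aux (α + η.toMeasure) (f := fun q => F ((η.add q.1).add q.2, q.1))
        (hF.comp ((Config.measurable_add.comp ((Config.measurable_add.comp
          (measurable_const.prodMk measurable_fst)).prodMk measurable_snd)).prodMk measurable_fst))
      simp only [Config.toMeasure_add, ← add_assoc]
      rw [this]
      simp only [Config.add_comm]
    simp_rw [h2]
    push_cast
    ring

/-- The Pascal law, as a mixture of the laws `urn α n`. -/
def pascalMix (p : ℝ) : Measure (Config E) :=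
  Measure.sum fun n =>
    ENNReal.ofReal ((1 - p) ^ (α.real Set.univ) * (p ^ n / n.factorial)) • urn α n

theorem mecke_pascalMix {p : ℝ} (hp : p ∈ Set.Ioo (0 : ℝ) 1) {F : Config E × E → ℝ≥0∞}
    (hF : Measurable F) :
    ∫⁻ η, ∫⁻ x, F (η, x) ∂η.toMeasure ∂pascalMix α p =
      ENNReal.ofReal p * ∫⁻ η, ∫⁻ x, F (η.add x, x) ∂(α + η.toMeasure) ∂pascalMix α p := by
  simp only [pascalMix, lintegral_sum_measure, lintegral_smul_measure]
  rw [tsum_eq_zero_add' ENNReal.summable, ← ENNReal.tsum_mul_left]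
  have h0 : ∫⁻ η, ∫⁻ x, F (η, x) ∂η.toMeasure ∂urn α 0 = 0 := by
    rw [urn, lintegral_dirac' _ (measurable_lintegral_kernel hF)]
    simp
  rw [h0, smul_zero, zero_add]
  refine tsum_congr fun n => ?_
  rw [mecke_urn α n hF, smul_eq_mul, smul_eq_mul, ← mul_assoc, ← mul_assoc]
  congr 1
  have h1 : ((n : ℝ≥0∞) + 1) = ENNReal.ofReal ((n : ℝ) + 1) := by
    rw [ENNReal.ofReal_add (by positivity) zero_le_one]; simp
  have h2 : (0 : ℝ) < 1 - p := by linarith [hp.2]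
  have h3 := hp.1
  rw [h1, ← ENNReal.ofReal_mul (by positivity), ← ENNReal.ofReal_mul (by positivity)]
  congr 1
  rw [Nat.factorial_succ, pow_succ]
  push_cast
  field_simp

end Mecke

/-- The Mecke (Papangelou) equation that characterises the Pascal law. -/
def IsMecke (p : ℝ) (α : Measure E) (ρ : Measure (Config E)) : Prop :=
  ∀ F : Config E × E → ℝ≥0∞, Measurable F →
    ∫⁻ η, ∫⁻ x, F (η, x) ∂η.toMeasure ∂ρ =
      ENNReal.ofReal p * ∫⁻ η, ∫⁻ x, F (η.add x, x) ∂(α + η.toMeasure) ∂ρ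

open Classical in
theorem Config.cnt_add {B : Set E} (hB : MeasurableSet B) (η : Config E) (x : E) :
    Config.cnt B (η.add x) = Config.cnt B η + if x ∈ B then 1 else 0 := by
  rw [Config.cnt_eq_iff hB]
  push_cast
  rw [Config.cast_cnt hB, Config.toMeasure_add, Measure.add_apply, Measure.dirac_apply' _ hB]
  by_cases h : x ∈ B <;> simp [h]

/-- The weights of the negative binomial law, without normalisation. -/
def nbWeight (p a : ℝ) (n : ℕ) : ℝ := p ^ n / n.factorial * (ascPochhammer ℝ n).eval a

theorem ascPochhammer_nonneg {a : ℝ} (ha : 0 ≤ a) (n : ℕ) :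
    0 ≤ (ascPochhammer ℝ n).eval a := by
  induction n with
  | zero => simp
  | succ n ih => rw [ascPochhammer_succ_eval]; positivity

theorem nbWeight_nonneg {p a : ℝ} (hp : 0 ≤ p) (ha : 0 ≤ a) (n : ℕ) : 0 ≤ nbWeight p a n := by
  have := ascPochhammer_nonneg ha n
  unfold nbWeight; positivity

theorem nbWeight_succ (p a : ℝ) (n : ℕ) :
    (n + 1) * nbWeight p a (n + 1) = p * (a + n) * nbWeight p a n := by
  unfold nbWeight
  rw [ascPochhammer_succ_eval, Nat.factorial_succ, pow_succ]
  push_cast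
  field_simp

theorem hasSum_nbWeight {p a : ℝ} (hp : p ∈ Set.Ioo (0 : ℝ) 1) :
    HasSum (nbWeight p a) ((1 - p) ^ (-a)) := by
  have h := (Real.one_div_one_sub_rpow_hasFPowerSeriesOnBall_zero a).hasSum
    (y := p) (by
      rw [Metric.mem_eball, edist_zero_right, Real.enorm_eq_ofReal hp.1.le]
      simpa using hp.2)
  simp only [zero_add] at h
  rw [Real.rpow_neg (by linarith [hp.2]), ← one_div]
  have e : nbWeight p a = fun n : ℕ =>
      (FormalMultilinearSeries.ofScalars ℝ (fun n => Ring.choose (a + n - 1) n) n)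
        fun _ => p := by
    funext n
    have h1 := Ring.factorial_nsmul_multichoose_eq_ascPochhammer a n
    have h2 : Ring.choose (a + n - 1) n = Ring.multichoose a n := by
      rw [Ring.choose]; congr 1; ring
    have h3 : (n.factorial : ℝ) ≠ 0 := by positivity
    rw [FormalMultilinearSeries.ofScalars_apply_eq, h2, nbWeight,
      ← Polynomial.ascPochhammer_smeval_eq_eval, ← h1]
    simp only [nsmul_eq_mul, smul_eq_mul]
    field_simp
  rw [e]
  exact h

section Joint

variable {p : ℝ} {α : Measure E} {ρ : Measure (Config E)}
  {ι : Type*} [Fintype ι] {B : ι → Set E}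

theorem measurableSet_joint (hB : ∀ i, MeasurableSet (B i)) (m : ι → ℕ) :
    MeasurableSet {η : Config E | ∀ i, Config.cnt (B i) η = m i} := by
  rw [Set.ofPred_forall]
  exact MeasurableSet.iInter fun i => Config.measurable_cnt (hB i) (measurableSet_singleton _)

theorem joint_succ [DecidableEq ι] (hM : IsMecke p α ρ)
    (hB : ∀ i, MeasurableSet (B i))
    (hd : Pairwise (Function.onFun Disjoint B)) (m : ι → ℕ) (i : ι) :
    ρ {η | ∀ j, Config.cnt (B j) η = Function.update m i (m i + 1) j} * ((m i : ℝ≥0∞) + 1) =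
      ENNReal.ofReal p * (α (B i) + m i) * ρ {η | ∀ j, Config.cnt (B j) η = m j} := by
  classical
  set S' := {η : Config E | ∀ j, Config.cnt (B j) η = Function.update m i (m i + 1) j} with hS'
  set S := {η : Config E | ∀ j, Config.cnt (B j) η = m j} with hS
  have mS' : MeasurableSet S' := measurableSet_joint hB _
  have mS : MeasurableSet S := measurableSet_joint hB _
  have hiff : ∀ η : Config E, ∀ x ∈ B i, (η.add x ∈ S' ↔ η ∈ S) := by
    intro η x hx
    simp only [hS', hS, Set.mem_ofPred_eq]
    refine forall_congr' fun j => ?_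
    rw [Config.cnt_add (hB j)]
    by_cases hj : j = i
    · subst hj; simp [hx]
    · have : x ∉ B j := fun hxj => Set.disjoint_left.1 (hd hj) hxj hx
      simp [hj, this]
  have key := hM ((S' ×ˢ B i).indicator 1) (measurable_one.indicator (mS'.prod (hB i)))
  have e1 : ∀ η : Config E, ∫⁻ x, (S' ×ˢ B i).indicator (1 : Config E × E → ℝ≥0∞) (η, x) ∂η.toMeasure =
      S'.indicator (fun _ => (m i : ℝ≥0∞) + 1) η := by
    intro η
    by_cases hη : η ∈ S'
    · have h1 : η.toMeasure (B i) = (m i : ℝ≥0∞) + 1 := by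
        have := hη i
        rw [Function.update_self, Config.cnt_eq_iff (hB i)] at this
        rw [this]; push_cast; rfl
      have h2 : ∀ x, (S' ×ˢ B i).indicator (1 : Config E × E → ℝ≥0∞) (η, x) = (B i).indicator 1 x := by
        intro x
        by_cases hx : x ∈ B i <;> simp [Set.indicator, hη, hx]
      simp_rw [h2]
      rw [lintegral_indicator_one (hB i), h1, Set.indicator_of_mem hη]
    · simp [Set.indicator, hη]
  have e2 : ∀ η : Config E,
      ∫⁻ x, (S' ×ˢ B i).indicator (1 : Config E × E → ℝ≥0∞) (η.add x, x) ∂(α + η.toMeasure) =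
      S.indicator (fun _ => α (B i) + m i) η := by
    intro η
    have h2 : ∀ x, (S' ×ˢ B i).indicator (1 : Config E × E → ℝ≥0∞) (η.add x, x) =
        if η ∈ S then (B i).indicator 1 x else 0 := by
      intro x
      by_cases hx : x ∈ B i <;> by_cases hη : η ∈ S <;> simp [Set.indicator, hη, hx, hiff]
    simp_rw [h2]
    by_cases hη : η ∈ S
    · simp only [hη, if_true]
      have := hη i
      rw [Config.cnt_eq_iff (hB i)] at this
      rw [lintegral_indicator_one (hB i), Set.indicator_of_mem hη, Measure.add_apply, this]
    · simp [hη]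
  simp_rw [e1, e2] at key
  rw [lintegral_indicator_const mS', lintegral_indicator_const mS] at key
  rw [mul_comm, key, mul_assoc]

theorem joint_update [DecidableEq ι] [IsFiniteMeasure α] (hp : p ∈ Set.Ioo (0 : ℝ) 1) (hM : IsMecke p α ρ)
    (hB : ∀ i, MeasurableSet (B i))
    (hd : Pairwise (Function.onFun Disjoint B)) (m : ι → ℕ) (i : ι) (k : ℕ) :
    ρ {η | ∀ j, Config.cnt (B j) η = Function.update m i k j} =
      ENNReal.ofReal (nbWeight p (α.real (B i)) k) *
        ρ {η | ∀ j, Config.cnt (B j) η = Function.update m i 0 j} := by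
  induction k with
  | zero => simp [nbWeight]
  | succ k ih =>
    have h := joint_succ hM hB hd (Function.update m i k) i
    simp only [Function.update_idem, Function.update_self] at h
    rw [ih] at h
    have hk : (k : ℝ≥0∞) + 1 = ENNReal.ofReal ((k : ℝ) + 1) := by
      rw [ENNReal.ofReal_add (by positivity) zero_le_one]; simp
    have hα : α (B i) + k = ENNReal.ofReal (α.real (B i) + k) := by
      rw [ENNReal.ofReal_add measureReal_nonneg (by positivity)]; simp
    have hk0 : (k : ℝ≥0∞) + 1 ≠ 0 := by simp
    have hkt : (k : ℝ≥0∞) + 1 ≠ ∞ := by finiteness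
    rw [← ENNReal.mul_left_inj hk0 hkt, h, mul_right_comm _ _ ((k : ℝ≥0∞) + 1), hk, hα,
      ← mul_assoc, ← ENNReal.ofReal_mul hp.1.le,
      ← ENNReal.ofReal_mul (mul_nonneg hp.1.le (by positivity)),
      ← ENNReal.ofReal_mul (nbWeight_nonneg hp.1.le measureReal_nonneg _),
      ← nbWeight_succ, mul_comm ((k : ℝ) + 1)]

theorem joint_eq [DecidableEq ι] [IsFiniteMeasure α] (hp : p ∈ Set.Ioo (0 : ℝ) 1) (hM : IsMecke p α ρ)
    (hB : ∀ i, MeasurableSet (B i))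
    (hd : Pairwise (Function.onFun Disjoint B)) (m : ι → ℕ) :
    ρ {η | ∀ j, Config.cnt (B j) η = m j} =
      (∏ i, ENNReal.ofReal (nbWeight p (α.real (B i)) (m i))) *
        ρ {η | ∀ j, Config.cnt (B j) η = 0} := by
  have : ∀ s : Finset ι, ρ {η | ∀ j, Config.cnt (B j) η = m j} =
      (∏ i ∈ s, ENNReal.ofReal (nbWeight p (α.real (B i)) (m i))) *
        ρ {η | ∀ j, Config.cnt (B j) η = if j ∈ s then 0 else m j} := by
    intro s
    induction s using Finset.induction_on with
    | empty => simp
    | insert i s his ih =>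
      rw [ih, Finset.prod_insert his]
      have h := joint_update hp hM hB hd (fun j => if j ∈ s then 0 else m j) i (m i)
      have e1 : Function.update (fun j => if j ∈ s then 0 else m j) i (m i) =
          fun j => if j ∈ s then 0 else m j := by
        ext j; by_cases hj : j = i
        · subst hj; simp [his]
        · simp [hj]
      have e2 : Function.update (fun j => if j ∈ s then 0 else m j) i 0 =
          fun j => if j ∈ insert i s then 0 else m j := by
        ext j; by_cases hj : j = i
        · subst hj; simp
        · simp [hj]
      rw [e1, e2] at h
      rw [h]
      ring
  simpa using this Finset.univ

theorem single_eq [IsFiniteMeasure α] (hp : p ∈ Set.Ioo (0 : ℝ) 1) (hM : IsMecke p α ρ) {U : Set E} (hU : MeasurableSet U) (n : ℕ) :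
    ρ {η | Config.cnt U η = n} =
      ENNReal.ofReal (nbWeight p (α.real U) n) * ρ {η | Config.cnt U η = 0} := by
  simpa using joint_eq hp hM (ι := Unit) (B := fun _ => U) (fun _ => hU)
    (fun i j h => (h rfl).elim) (fun _ => n)

theorem total_eq [IsFiniteMeasure α] (hp : p ∈ Set.Ioo (0 : ℝ) 1) (hM : IsMecke p α ρ) {U : Set E} (hU : MeasurableSet U) :
    ρ Set.univ = ENNReal.ofReal ((1 - p) ^ (-α.real U)) * ρ {η | Config.cnt U η = 0} := by
  have hun : (Set.univ : Set (Config E)) = ⋃ n : ℕ, {η | Config.cnt U η = n} := by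
    ext η; simp
  rw [hun, measure_iUnion]
  · rw [tsum_congr (single_eq hp hM hU), ENNReal.tsum_mul_right, ← (hasSum_nbWeight hp).tsum_eq,
      ENNReal.ofReal_tsum_of_nonneg
      (nbWeight_nonneg hp.1.le measureReal_nonneg) (hasSum_nbWeight hp).summable]
  · intro i j hij
    refine Set.disjoint_left.2 fun η h1 h2 => hij ?_
    simp only [Set.mem_ofPred_eq] at h1 h2
    omega
  · exact fun n => Config.measurable_cnt hU (measurableSet_singleton n)

theorem zero_eq [IsFiniteMeasure α] (hp : p ∈ Set.Ioo (0 : ℝ) 1) (hM : IsMecke p α ρ) [IsProbabilityMeasure ρ] {U : Set E} (hU : MeasurableSet U) :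
    ρ {η | Config.cnt U η = 0} = ENNReal.ofReal ((1 - p) ^ (α.real U)) := by
  have h := total_eq hp hM hU
  have h1 : (0 : ℝ) < 1 - p := by linarith [hp.2]
  rw [measure_univ] at h
  calc ρ {η | Config.cnt U η = 0} = ENNReal.ofReal ((1 - p) ^ (α.real U)) *
        (ENNReal.ofReal ((1 - p) ^ (-α.real U)) * ρ {η | Config.cnt U η = 0}) := by
        rw [← mul_assoc, ← ENNReal.ofReal_mul (by positivity), ← Real.rpow_add h1]
        simp
    _ = _ := by rw [← h, mul_one]

theorem joint_eq_prod [IsFiniteMeasure α] (hp : p ∈ Set.Ioo (0 : ℝ) 1) (hM : IsMecke p α ρ)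
    (hB : ∀ i, MeasurableSet (B i))
    (hd : Pairwise (Function.onFun Disjoint B)) [IsProbabilityMeasure ρ] (m : ι → ℕ) :
    ρ {η | ∀ j, Config.cnt (B j) η = m j} = ∏ i, ρ {η | Config.cnt (B i) η = m i} := by
  have h1 : (0 : ℝ) < 1 - p := by linarith [hp.2]
  have hU : MeasurableSet (⋃ i, B i) := MeasurableSet.iUnion hB
  have h0 : {η : Config E | ∀ j, Config.cnt (B j) η = 0} =
      {η | Config.cnt (⋃ i, B i) η = 0} := by
    ext η
    simp only [Set.mem_ofPred_eq, Config.cnt_eq_iff hU, Config.cnt_eq_iff (hB _)]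
    simp
  classical
  rw [joint_eq hp hM hB hd, h0, zero_eq hp hM hU]
  simp_rw [fun i => single_eq hp hM (hB i) (m i), fun i => zero_eq hp hM (hB i)]
  rw [Finset.prod_mul_distrib]
  congr 1
  rw [← ENNReal.ofReal_prod_of_nonneg (fun i _ => by positivity),
    ← Real.rpow_sum_of_pos h1, measureReal_iUnion_fintype hd hB]

theorem IsMecke.isPascalLaw [IsFiniteMeasure α] (hp : p ∈ Set.Ioo (0 : ℝ) 1) (hM : IsMecke p α ρ) [IsProbabilityMeasure ρ] : IsPascalLaw p α ρ where
  isProbabilityMeasure := inferInstance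
  count := by
    intro B hB n
    have h1 : (0 : ℝ) < 1 - p := by linarith [hp.2]
    simp_rw [← Config.cnt_eq_iff hB]
    rw [single_eq hp hM hB, zero_eq hp hM hB,
      ← ENNReal.ofReal_mul (nbWeight_nonneg hp.1.le measureReal_nonneg _), nbWeight]
    congr 1
    ring
  indep := by
    intro n _ B hB hd
    have h : iIndepFun (fun i (η : Config E) => Config.cnt (B i) η) ρ := by
      rw [iIndepFun_iff_map_fun_eq_pi_map
        (fun i => (Config.measurable_cnt (hB i)).aemeasurable)]
      have : ∀ i, IsProbabilityMeasure (ρ.map (Config.cnt (B i))) := fun i =>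
        Measure.isProbabilityMeasure_map (Config.measurable_cnt (hB i)).aemeasurable
      refine Measure.ext_of_singleton fun m => ?_
      rw [Measure.map_apply (measurable_pi_lambda _ fun i => Config.measurable_cnt (hB i))
        (measurableSet_singleton m), Measure.pi_singleton]
      have h1 : (fun (η : Config E) i => Config.cnt (B i) η) ⁻¹' {m} =
          {η | ∀ j, Config.cnt (B j) η = m j} := by
        ext η; simp [funext_iff]
      rw [h1, joint_eq_prod hp hM hB hd]
      refine Finset.prod_congr rfl fun i _ => ?_
      rw [Measure.map_apply (Config.measurable_cnt (hB i)) (measurableSet_singleton _)]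
      rfl
    have h2 := h.comp (fun _ (n : ℕ) => (n : ℝ≥0∞)) (fun _ => measurable_from_nat)
    convert h2 using 2 with i
    ext η
    exact (Config.cast_cnt (hB i) η).symm

end Joint

theorem pascalMix_isPascalLaw {p : ℝ} (hp : p ∈ Set.Ioo (0 : ℝ) 1) (α : Measure E)
    [IsFiniteMeasure α] : IsPascalLaw p α (pascalMix α p) := by
  have hM : IsMecke p α (pascalMix α p) := fun F hF => mecke_pascalMix α hp hF
  have h1 : (0 : ℝ) < 1 - p := by linarith [hp.2]
  have hm : MeasurableSet {η : Config E | Config.cnt Set.univ η = 0} :=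
    Config.measurable_cnt MeasurableSet.univ (measurableSet_singleton 0)
  have h0 : pascalMix α p {η | Config.cnt Set.univ η = 0} =
      ENNReal.ofReal ((1 - p) ^ (α.real Set.univ)) := by
    rw [pascalMix, Measure.sum_apply _ hm, tsum_eq_single 0]
    · have : (0 : Config E) ∈ {η : Config E | Config.cnt Set.univ η = 0} := by
        simp [Config.cnt]
      simp [urn, Measure.dirac_apply' _ hm, this]
    · intro n hn
      obtain ⟨k, rfl⟩ := Nat.exists_eq_succ_of_ne_zero hn
      have : urn α (k + 1) {η | Config.cnt Set.univ η = 0} = 0 := by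
        rw [← lintegral_indicator_one hm, lintegral_urn_succ α k (measurable_one.indicator hm)]
        simp [Set.indicator, Config.cnt_add MeasurableSet.univ]
      simp [this]
  have : IsProbabilityMeasure (pascalMix α p) := ⟨by
    rw [total_eq hp hM MeasurableSet.univ, h0, ← ENNReal.ofReal_mul (by positivity),
      ← Real.rpow_add h1]
    simp⟩
  exact hM.isPascalLaw hp


section Unique

variable {p : ℝ} {α : Measure E} {ρ ρ' : Measure (Config E)}

theorem IsPascalLaw.map_cnt_eq (h : IsPascalLaw p α ρ) (h' : IsPascalLaw p α ρ') {B : Set E}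
    (hB : MeasurableSet B) : ρ.map (Config.cnt B) = ρ'.map (Config.cnt B) := by
  refine Measure.ext_of_singleton fun n => ?_
  rw [Measure.map_apply (Config.measurable_cnt hB) (measurableSet_singleton n),
    Measure.map_apply (Config.measurable_cnt hB) (measurableSet_singleton n)]
  have : Config.cnt B ⁻¹' {n} = {η : Config E | η.toMeasure B = n} := by
    ext η; simp [Config.cnt_eq_iff hB]
  rw [this, h.count B hB, h'.count B hB]

theorem IsPascalLaw.map_eq_pi (h : IsPascalLaw p α ρ) {n : ℕ} {B : Fin n → Set E}
    (hn : 2 ≤ n) (hB : ∀ i, MeasurableSet (B i)) (hd : Pairwise (Function.onFun Disjoint B)) :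
    ρ.map (fun η i => Config.cnt (B i) η) = Measure.pi fun i => ρ.map (Config.cnt (B i)) := by
  have := h.isProbabilityMeasure
  have h1 := (h.indep n hn B hB hd).comp (fun _ (c : ℝ≥0∞) => ⌊c.toReal⌋₊)
    (fun _ => Nat.measurable_floor.comp ENNReal.measurable_toReal)
  exact (iIndepFun_iff_map_fun_eq_pi_map
    (fun i => (Config.measurable_cnt (hB i)).aemeasurable)).1 h1

theorem IsPascalLaw.map_joint_eq (h : IsPascalLaw p α ρ) (h' : IsPascalLaw p α ρ')
    {ι : Type*} [Finite ι] {B : ι → Set E} (hB : ∀ i, MeasurableSet (B i))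
    (hd : Pairwise (Function.onFun Disjoint B)) :
    ρ.map (fun η i => Config.cnt (B i) η) = ρ'.map (fun η i => Config.cnt (B i) η) := by
  have := h.isProbabilityMeasure
  have := h'.isProbabilityMeasure
  obtain ⟨n, ⟨e⟩⟩ := Finite.exists_equiv_fin ι
  -- pad with two empty sets, so that there are at least two sets
  let C : Fin (n + 2) → Set E := fun i => if hi : (i : ℕ) < n then B (e.symm ⟨i, hi⟩) else ∅
  have hC : ∀ i, MeasurableSet (C i) := by
    intro i; simp only [C]; split_ifs
    · exact hB _
    · exact MeasurableSet.empty
  have hCd : Pairwise (Function.onFun Disjoint C) := by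
    intro i j hij
    simp only [Function.onFun, C]
    split_ifs with h1 h2
    · refine hd fun heq => hij ?_
      have := e.symm.injective heq
      exact Fin.ext (by simpa using this)
    all_goals simp
  have hpi : ρ.map (fun η i => Config.cnt (C i) η) = ρ'.map (fun η i => Config.cnt (C i) η) := by
    rw [h.map_eq_pi (by omega) hC hCd, h'.map_eq_pi (by omega) hC hCd]
    congr 1
    funext i
    exact h.map_cnt_eq h' (hC i)
  have hm : Measurable fun (η : Config E) i => Config.cnt (C i) η :=
    measurable_pi_lambda _ fun i => Config.measurable_cnt (hC i)
  let g : (Fin (n + 2) → ℕ) → ι → ℕ := fun c i => c ⟨e i, by omega⟩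
  have hg : Measurable g := measurable_pi_lambda _ fun i => measurable_pi_apply _
  have hcomp : (fun (η : Config E) i => Config.cnt (B i) η) =
      g ∘ fun (η : Config E) i => Config.cnt (C i) η := by
    funext η i
    simp [g, C]
  rw [hcomp, ← Measure.map_map hg hm, hpi, Measure.map_map hg hm]

theorem IsPascalLaw.unique (h : IsPascalLaw p α ρ) (h' : IsPascalLaw p α ρ') : ρ = ρ' := by
  classical
  have := h.isProbabilityMeasure
  have := h'.isProbabilityMeasure
  let m : {B : Set E // MeasurableSet B} → MeasurableSpace (Config E) := fun B =>
    MeasurableSpace.comap (fun η : Config E => η.toMeasure B) inferInstance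
  refine ext_of_generate_finite
    (piiUnionInter (fun B => {s | MeasurableSet[m B] s}) Set.univ)
    ?_ (isPiSystem_piiUnionInter _ (fun B => @MeasurableSpace.isPiSystem_measurableSet _ (m B)) _)
    ?_ (by simp)
  · rw [generateFrom_piiUnionInter_measurableSet m Set.univ]
    simp only [Set.mem_univ, iSup_pos]
    rfl
  rintro s ⟨t, -, f, hf, rfl⟩
  choose! S hS hSf using fun B (hB : B ∈ t) => hf B hB
  -- the atoms of the finite algebra generated by the sets in `t`
  let A : (t → Bool) → Set E := fun b => {x | ∀ B : t, (x ∈ B.1.1 ↔ b B = true)}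
  have hA : ∀ b, MeasurableSet (A b) := by
    intro b
    simp only [A, Set.ofPred_forall]
    refine MeasurableSet.iInter fun B => ?_
    by_cases hb : b B = true
    · simp only [hb, iff_true]; exact B.1.2
    · simp only [hb, Bool.false_eq_true, iff_false]; exact B.1.2.compl
  have hAd : Pairwise (Function.onFun Disjoint A) := by
    intro b c hbc
    refine Set.disjoint_left.2 fun x hx hx' => hbc ?_
    funext B
    have h1 := hx B
    have h2 := hx' B
    rw [h1] at h2
    exact Bool.eq_iff_iff.2 h2
  have hdec : ∀ (B : t) (η : Config E), η.toMeasure B.1.1 =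
      ∑ b : t → Bool, if b B = true then (Config.cnt (A b) η : ℝ≥0∞) else 0 := by
    intro B η
    have hBU : B.1.1 = ⋃ b ∈ Finset.univ.filter (fun b : t → Bool => b B = true), A b := by
      ext x
      simp only [Finset.mem_filter, Finset.mem_univ, true_and, Set.mem_iUnion, exists_prop]
      constructor
      · intro hx
        exact ⟨fun C => decide (x ∈ C.1.1), by simpa using hx, fun C => by simp⟩
      · rintro ⟨b, hb, hx⟩
        exact (hx B).2 hb
    conv_lhs => rw [hBU]
    rw [measure_biUnion_finset (fun b _ c _ hbc => hAd hbc) (fun b _ => hA b),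
      Finset.sum_filter]
    simp only [Config.cast_cnt (hA _)]
  have hset : (⋂ B ∈ t, f B) = (fun (η : Config E) b => Config.cnt (A b) η) ⁻¹'
      {c | ∀ B : t, (∑ b : t → Bool, if b B = true then (c b : ℝ≥0∞) else 0) ∈ S B.1} := by
    ext η
    simp only [Set.mem_iInter, Set.mem_preimage, Set.mem_ofPred_eq, ← hdec]
    constructor
    · intro hη B
      have := hη B.1 B.2
      rwa [← hSf B.1 B.2] at this
    · intro hη B hB
      rw [← hSf B hB]
      exact hη ⟨B, hB⟩
  have hmeas : Measurable fun (η : Config E) b => Config.cnt (A b) η :=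
    measurable_pi_lambda _ fun b => Config.measurable_cnt (hA b)
  rw [hset, ← Measure.map_apply hmeas (Set.to_countable _).measurableSet,
    ← Measure.map_apply hmeas (Set.to_countable _).measurableSet, h.map_joint_eq h' hA hAd]

end Unique

/-- Existence and uniqueness of the Pascal law. -/
theorem existsUnique_isPascalLaw (p : Set.Ioo (0 : ℝ) 1) (α : Measure E) [IsFiniteMeasure α] :
    ∃! ρ : Measure (Config E), IsPascalLaw p α ρ :=
  ⟨pascalMix α p, pascalMix_isPascalLaw p.2 α, fun _ h => h.unique (pascalMix_isPascalLaw p.2 α)⟩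

/-- The law `ρ_{p, α}` of the Pascal point process. -/
def pascalLaw (p : Set.Ioo (0 : ℝ) 1) (α : Measure E) [IsFiniteMeasure α] :
    Measure (Config E) :=
  (existsUnique_isPascalLaw p α).choose

theorem isPascalLaw_pascalLaw (p : Set.Ioo (0 : ℝ) 1) (α : Measure E) [IsFiniteMeasure α] :
    IsPascalLaw p α (pascalLaw p α) :=
  (existsUnique_isPascalLaw p α).choose_spec.1

instance (p : Set.Ioo (0 : ℝ) 1) (α : Measure E) [IsFiniteMeasure α] :
    IsProbabilityMeasure (pascalLaw p α) :=
  (isPascalLaw_pascalLaw p α).isProbabilityMeasure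

theorem isMecke_pascalLaw (p : Set.Ioo (0 : ℝ) 1) (α : Measure E) [IsFiniteMeasure α] :
    IsMecke p α (pascalLaw p α) := by
  rw [(isPascalLaw_pascalLaw p α).unique (pascalMix_isPascalLaw p.2 α)]
  exact fun F hF => mecke_pascalMix α p.2 hF

/-! ### Raising and lowering operators -/

/-- Bounded measurable functions `φ : E → ℂ`. -/
abbrev BddMeasurable (E : Type*) [MeasurableSpace E] : Type _ :=
  {φ : E → ℂ // Measurable φ ∧ ∃ C : ℝ, ∀ x, ‖φ x‖ ≤ C}

/-- The constant function `1` on `E`. -/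
def one (E : Type*) [MeasurableSpace E] : BddMeasurable E :=
  ⟨fun _ => 1, measurable_const, 1, fun _ => by simp⟩

/-- The bounded measurable functions `F` on configurations for which there is a cutoff `m` such
that `F` vanishes outside `{η | η(E) ≤ m}`. -/
def cutoffFun (E : Type*) [MeasurableSpace E] : Submodule ℂ (Config E → ℂ) where
  carrier := {F | Measurable F ∧ (∃ C : ℝ, ∀ η, ‖F η‖ ≤ C) ∧
    ∃ m : ℕ, ∀ η, F η ≠ 0 → η.toMeasure Set.univ ≤ m}
  zero_mem' := ⟨measurable_const, ⟨0, by simp⟩, 0, by simp⟩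
  add_mem' := by
    rintro F G ⟨hF, ⟨C, hC⟩, m, hm⟩ ⟨hG, ⟨D, hD⟩, n, hn⟩
    refine ⟨hF.add hG, ⟨C + D, fun η => (norm_add_le _ _).trans (add_le_add (hC η) (hD η))⟩,
      max m n, fun η hη => ?_⟩
    by_cases h : F η = 0
    · have hG0 : G η ≠ 0 := fun h' => hη (by simp [h, h'])
      exact (hn η hG0).trans (by exact_mod_cast le_max_right m n)
    · exact (hm η h).trans (by exact_mod_cast le_max_left m n)
  smul_mem' := by
    rintro c F ⟨hF, ⟨C, hC⟩, m, hm⟩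
    refine ⟨hF.const_smul c, ⟨‖c‖ * C, fun η => ?_⟩, m, fun η hη => hm η fun h => hη (by simp [h])⟩
    rw [Pi.smul_apply, norm_smul]
    exact mul_le_mul_of_nonneg_left (hC η) (norm_nonneg c)

/-- `k⁺(φ) F (η) = p^(-1/2) ∫ φ(x) F(η - δ_x) η(dx)`. -/
def raiseFun (p : ℝ) (φ : E → ℂ) (F : Config E → ℂ) (η : Config E) : ℂ :=
  (1 / Real.sqrt p : ℝ) * ∫ x, φ x * F (η.remove x) ∂η.toMeasure

/-- `k⁻(φ) F (η) = p^(1/2) ∫ conj φ(x) F(η + δ_x) (α + η)(dx)`. -/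
def lowerFun (p : ℝ) (α : Measure E) (φ : E → ℂ) (F : Config E → ℂ) (η : Config E) : ℂ :=
  (Real.sqrt p : ℝ) * ∫ x, conj (φ x) * F (η.add x) ∂(α + η.toMeasure)

section Operators

open Classical in
/-- A jointly measurable version of `η - δ_x`. -/
def removeAux (q : Config E × E) : Config E :=
  if q.1.toMeasure {q.2} = 0 then 0 else q.1.remove q.2

theorem measurable_removeAux [StandardBorelSpace E] :
    Measurable (removeAux : Config E × E → Config E) :=
  Config.measurable_remove

theorem removeAux_ae [StandardBorelSpace E] (η : Config E) :
    ∀ᵐ x ∂η.toMeasure, removeAux (η, x) = η.remove x ∧ (η.remove x).add x = η := by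
  filter_upwards [η.ae_mass_ne_zero] with x hx
  exact ⟨by simp [removeAux, hx], Config.add_remove hx⟩

theorem raise_integral_eq [StandardBorelSpace E] (φ : E → ℂ) (F : Config E → ℂ)
    (η : Config E) :
    ∫ x, φ x * F (η.remove x) ∂η.toMeasure = ∫ x, φ x * F (removeAux (η, x)) ∂η.toMeasure := by
  refine integral_congr_ae ?_
  filter_upwards [removeAux_ae η] with x hx
  rw [hx.1]

theorem integrable_raise [StandardBorelSpace E] (φ : BddMeasurable E)
    {F : Config E → ℂ} (hF : F ∈ cutoffFun E)
    (η : Config E) : Integrable (fun x => φ.1 x * F (η.remove x)) η.toMeasure := by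
  obtain ⟨hFm, ⟨C, hC⟩, -⟩ := hF
  obtain ⟨φ, hφm, D, hD⟩ := φ
  have h : Integrable (fun x => φ x * F (removeAux (η, x))) η.toMeasure := by
    refine Integrable.of_bound (C := D * C) ?_ (Filter.Eventually.of_forall fun x => ?_)
    · exact (hφm.mul (hFm.comp (measurable_removeAux.comp
        measurable_prodMk_left))).aestronglyMeasurable
    · rw [norm_mul]
      exact mul_le_mul (hD x) (hC _) (norm_nonneg _) ((norm_nonneg _).trans (hD x))
  refine h.congr ?_
  filter_upwards [removeAux_ae η] with x hx
  rw [hx.1]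

theorem integrable_lower (α : Measure E) [IsFiniteMeasure α] (φ : BddMeasurable E)
    {F : Config E → ℂ} (hF : F ∈ cutoffFun E) (η : Config E) :
    Integrable (fun x => conj (φ.1 x) * F (η.add x)) (α + η.toMeasure) := by
  obtain ⟨hFm, ⟨C, hC⟩, -⟩ := hF
  obtain ⟨φ, hφm, D, hD⟩ := φ
  refine Integrable.of_bound (C := D * C) ?_ (Filter.Eventually.of_forall fun x => ?_)
  · exact ((Complex.continuous_conj.measurable.comp hφm).mul (hFm.comp
      (Config.measurable_add.comp measurable_prodMk_left))).aestronglyMeasurable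
  · rw [norm_mul, RCLike.norm_conj]
    exact mul_le_mul (hD x) (hC _) (norm_nonneg _) ((norm_nonneg _).trans (hD x))

theorem raiseFun_mem [StandardBorelSpace E] (p : ℝ) (φ : BddMeasurable E)
    {F : Config E → ℂ} (hF : F ∈ cutoffFun E) :
    raiseFun p φ.1 F ∈ cutoffFun E := by
  obtain ⟨hFm, ⟨C, hC⟩, m, hm⟩ := hF
  obtain ⟨φ, hφm, D, hD⟩ := φ
  have hsupp : ∀ η, raiseFun p φ F η ≠ 0 → η.toMeasure Set.univ ≤ ((m + 1 : ℕ) : ℝ≥0∞) := by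
    intro η hη
    by_contra hcon
    refine hη ?_
    rw [raiseFun, integral_eq_zero_of_ae, mul_zero]
    filter_upwards [removeAux_ae η] with x hx
    by_cases h0 : F (η.remove x) = 0
    · simp [h0]
    · refine (hcon ?_).elim
      have h1 := hm _ h0
      rw [← hx.2, Config.toMeasure_add, Measure.add_apply]
      push_cast
      exact add_le_add h1 (by simp)
  refine ⟨?_, ⟨|1 / Real.sqrt p| * (|D| * |C| * (m + 1)), fun η => ?_⟩, m + 1, hsupp⟩
  · have h : StronglyMeasurable fun q : Config E × E => φ q.2 * F (removeAux q) :=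
      ((hφm.comp measurable_snd).mul (hFm.comp measurable_removeAux)).stronglyMeasurable
    have h2 := (h.integral_kernel_prod_right' (κ := Config.kernel E)).measurable
    have : raiseFun p φ F = fun η => ((1 / Real.sqrt p : ℝ) : ℂ) *
        ∫ x, φ x * F (removeAux (η, x)) ∂(Config.kernel E η) := by
      funext η
      rw [raiseFun, raise_integral_eq]; rfl
    rw [this]
    exact h2.const_mul _
  · by_cases h0 : raiseFun p φ F η = 0
    · rw [h0, norm_zero]; positivity
    have hmass : η.toMeasure.real Set.univ ≤ m + 1 := by
      have := ENNReal.toReal_mono (ENNReal.natCast_ne_top _) (hsupp η h0)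
      rw [ENNReal.toReal_natCast] at this
      exact_mod_cast this
    rw [raiseFun, norm_mul, Complex.norm_real, Real.norm_eq_abs]
    refine mul_le_mul_of_nonneg_left ?_ (abs_nonneg _)
    refine (norm_integral_le_of_norm_le_const (C := |D| * |C|)
      (Filter.Eventually.of_forall fun x => ?_)).trans
      (mul_le_mul_of_nonneg_left hmass (by positivity))
    rw [norm_mul]
    exact mul_le_mul ((hD x).trans (le_abs_self D)) ((hC _).trans (le_abs_self C))
      (norm_nonneg _) (abs_nonneg _)

theorem lowerFun_mem (p : ℝ) (α : Measure E) [IsFiniteMeasure α] (φ : BddMeasurable E)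
    {F : Config E → ℂ} (hF : F ∈ cutoffFun E) : lowerFun p α φ.1 F ∈ cutoffFun E := by
  obtain ⟨hFm, ⟨C, hC⟩, m, hm⟩ := hF
  obtain ⟨φ, hφm, D, hD⟩ := φ
  have hsupp : ∀ η, lowerFun p α φ F η ≠ 0 → η.toMeasure Set.univ ≤ (m : ℝ≥0∞) := by
    intro η hη
    by_contra hcon
    refine hη ?_
    rw [lowerFun, integral_eq_zero_of_ae, mul_zero]
    refine Filter.Eventually.of_forall fun x => ?_
    by_cases h0 : F (η.add x) = 0
    · simp [h0]
    · refine (hcon ?_).elim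
      refine le_trans ?_ (hm _ h0)
      rw [Config.toMeasure_add, Measure.add_apply]
      exact le_self_add
  refine ⟨?_, ⟨|Real.sqrt p| * (|D| * |C| * (α.real Set.univ + m)), fun η => ?_⟩, m, hsupp⟩
  · have h : StronglyMeasurable fun q : Config E × E => conj (φ q.2) * F (q.1.add q.2) :=
      ((Complex.continuous_conj.measurable.comp (hφm.comp measurable_snd)).mul
        (hFm.comp Config.measurable_add)).stronglyMeasurable
    exact (h.integral_kernel_prod_right'
      (κ := Kernel.const (Config E) α + Config.kernel E)).measurable.const_mul _
  · by_cases h0 : lowerFun p α φ F η = 0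
    · rw [h0, norm_zero]; positivity
    have hmass : (α + η.toMeasure).real Set.univ ≤ α.real Set.univ + m := by
      have := ENNReal.toReal_mono (ENNReal.natCast_ne_top _) (hsupp η h0)
      rw [ENNReal.toReal_natCast] at this
      rw [measureReal_add_apply]
      exact add_le_add le_rfl this
    rw [lowerFun, norm_mul, Complex.norm_real, Real.norm_eq_abs]
    refine mul_le_mul_of_nonneg_left ?_ (abs_nonneg _)
    refine (norm_integral_le_of_norm_le_const (C := |D| * |C|)
      (Filter.Eventually.of_forall fun x => ?_)).trans
      (mul_le_mul_of_nonneg_left hmass (by positivity))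
    rw [norm_mul, RCLike.norm_conj]
    exact mul_le_mul ((hD x).trans (le_abs_self D)) ((hC _).trans (le_abs_self C))
      (norm_nonneg _) (abs_nonneg _)

/-- `k⁺(φ)` on functions. -/
def raiseLin [StandardBorelSpace E] (p : ℝ) (φ : BddMeasurable E) :
    cutoffFun E →ₗ[ℂ] cutoffFun E where
  toFun F := ⟨raiseFun p φ.1 F.1, raiseFun_mem p φ F.2⟩
  map_add' F G := by
    ext η
    simp only [raiseFun, Submodule.coe_add, Pi.add_apply, mul_add]
    rw [integral_add (integrable_raise φ F.2 η) (integrable_raise φ G.2 η), mul_add]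
  map_smul' c F := by
    ext η
    simp only [raiseFun, Submodule.coe_smul, Pi.smul_apply, smul_eq_mul, RingHom.id_apply]
    simp_rw [mul_left_comm _ c]
    rw [integral_const_mul, mul_left_comm]

/-- `k⁻(φ)` on functions. -/
def lowerLin (p : ℝ) (α : Measure E) [IsFiniteMeasure α] (φ : BddMeasurable E) :
    cutoffFun E →ₗ[ℂ] cutoffFun E where
  toFun F := ⟨lowerFun p α φ.1 F.1, lowerFun_mem p α φ F.2⟩
  map_add' F G := by
    ext η
    simp only [lowerFun, Submodule.coe_add, Pi.add_apply, mul_add]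
    rw [integral_add (integrable_lower α φ F.2 η) (integrable_lower α φ G.2 η), mul_add]
  map_smul' c F := by
    ext η
    simp only [lowerFun, Submodule.coe_smul, Pi.smul_apply, smul_eq_mul, RingHom.id_apply]
    simp_rw [mul_left_comm _ c]
    rw [integral_const_mul, mul_left_comm]

variable (p : Set.Ioo (0 : ℝ) 1) (α : Measure E) [IsFiniteMeasure α]

/-- The Hilbert space `L²(ρ_{p, α})` of complex-valued functions. -/
abbrev Hilb : Type _ := Lp ℂ 2 (pascalLaw p α)

theorem memLp_cutoffFun (F : cutoffFun E) : MemLp F.1 2 (pascalLaw p α) := by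
  obtain ⟨C, hC⟩ := F.2.2.1
  exact MemLp.of_bound F.2.1.aestronglyMeasurable C (Filter.Eventually.of_forall hC)

/-- The map that sends a function to its class in `L²`. -/
def toL2 : cutoffFun E →ₗ[ℂ] Hilb p α where
  toFun F := (memLp_cutoffFun p α F).toLp F.1
  map_add' _ _ := rfl
  map_smul' _ _ := rfl

/-- The domain `𝒟 ⊆ L²(ρ_{p, α})`: the classes of bounded measurable functions with bounded
particle number. -/
abbrev dom : Submodule ℂ (Hilb p α) := LinearMap.range (toL2 p α)

theorem mem_ker_toL2 (F : cutoffFun E) :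
    F ∈ LinearMap.ker (toL2 p α) ↔ F.1 =ᵐ[pascalLaw p α] 0 := by
  rw [LinearMap.mem_ker]
  exact MemLp.toLp_eq_toLp_iff (memLp_cutoffFun p α F) MemLp.zero

theorem raise_ker [StandardBorelSpace E] (φ : BddMeasurable E) :
    LinearMap.ker (toL2 p α) ≤ (LinearMap.ker (toL2 p α)).comap (raiseLin p φ) := by
  intro F hF
  rw [Submodule.mem_comap, mem_ker_toL2]
  rw [mem_ker_toL2] at hF
  have hFm : Measurable F.1 := F.2.1
  have hG : Measurable fun q : Config E × E =>
      Set.indicator {q : Config E × E | q.1.toMeasure {q.2} ≠ 0}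
        (fun q => ‖F.1 (removeAux q)‖ₑ) q :=
    (hFm.comp measurable_removeAux).enorm.indicator
      (Config.measurable_mass (measurableSet_singleton 0)).compl
  have key := isMecke_pascalLaw p α _ hG
  have h0 : ∫⁻ η, ∫⁻ x, Set.indicator {q : Config E × E | q.1.toMeasure {q.2} ≠ 0}
        (fun q => ‖F.1 (removeAux q)‖ₑ) (η.add x, x) ∂(α + η.toMeasure) ∂pascalLaw p α = 0 := by
    rw [lintegral_congr_ae (g := 0), Pi.zero_def, lintegral_zero]
    filter_upwards [hF] with η hη
    rw [lintegral_congr (g := fun _ => 0), lintegral_zero, Pi.zero_apply]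
    intro x
    have hx : (η.add x).toMeasure {x} ≠ 0 := by simp
    simp [Set.indicator, removeAux, Config.remove_add, hη]
  rw [h0, mul_zero, lintegral_eq_zero_iff (measurable_lintegral_kernel hG)] at key
  filter_upwards [key] with η hη
  replace hη := (lintegral_eq_zero_iff (hG.comp (measurable_prodMk_left (x := η)))).1 hη
  change raiseFun p φ.1 F.1 η = 0
  rw [raiseFun, integral_eq_zero_of_ae, mul_zero]
  filter_upwards [hη, removeAux_ae η, η.ae_mass_ne_zero] with x h1 h2 h3
  have : F.1 (η.remove x) = 0 := by simpa [Set.indicator, h3, h2.1] using h1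
  simp [this]

theorem lower_ker (φ : BddMeasurable E) :
    LinearMap.ker (toL2 p α) ≤ (LinearMap.ker (toL2 p α)).comap (lowerLin p α φ) := by
  intro F hF
  rw [Submodule.mem_comap, mem_ker_toL2]
  rw [mem_ker_toL2] at hF
  have hFm : Measurable F.1 := F.2.1
  have key := isMecke_pascalLaw p α (fun q => ‖F.1 q.1‖ₑ) (hFm.comp measurable_fst).enorm
  have h0 : ∫⁻ η, ∫⁻ _, ‖F.1 η‖ₑ ∂η.toMeasure ∂pascalLaw p α = 0 := by
    rw [lintegral_congr_ae (g := 0), Pi.zero_def, lintegral_zero]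
    filter_upwards [hF] with η hη
    simp [hη]
  have hG : Measurable fun q : Config E × E => ‖F.1 (q.1.add q.2)‖ₑ :=
    (hFm.comp Config.measurable_add).enorm
  rw [h0, eq_comm, mul_eq_zero, or_iff_right (by simpa using p.2.1),
    lintegral_eq_zero_iff (measurable_lintegral_add α hG)] at key
  filter_upwards [key] with η hη
  replace hη := (lintegral_eq_zero_iff (hG.comp (measurable_prodMk_left (x := η)))).1 hη
  change lowerFun p α φ.1 F.1 η = 0
  rw [lowerFun, integral_eq_zero_of_ae, mul_zero]
  filter_upwards [hη] with x h1
  have : F.1 (η.add x) = 0 := by simpa using h1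
  simp [this]

/-- An operator on functions that respects almost everywhere equality, as an operator on the
domain `𝒟 ⊆ L²(ρ_{p, α})`. -/
def descend (k : cutoffFun E →ₗ[ℂ] cutoffFun E)
    (hk : LinearMap.ker (toL2 p α) ≤ (LinearMap.ker (toL2 p α)).comap k) :
    dom p α →ₗ[ℂ] dom p α :=
  (toL2 p α).quotKerEquivRange.toLinearMap ∘ₗ Submodule.mapQ _ _ k hk ∘ₗ
    (toL2 p α).quotKerEquivRange.symm.toLinearMap

/-- `descend` acts on the class of `F` by applying the operator to the function `F`. -/
theorem descend_apply (k : cutoffFun E →ₗ[ℂ] cutoffFun E)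
    (hk : LinearMap.ker (toL2 p α) ≤ (LinearMap.ker (toL2 p α)).comap k) (F : cutoffFun E) :
    descend p α k hk ⟨toL2 p α F, F, rfl⟩ = ⟨toL2 p α (k F), k F, rfl⟩ := by
  have : (toL2 p α).quotKerEquivRange.symm ⟨toL2 p α F, F, rfl⟩ = Submodule.Quotient.mk F :=
    (toL2 p α).quotKerEquivRange_symm_apply_image F _
  rw [descend, LinearMap.comp_apply, LinearMap.comp_apply, LinearEquiv.coe_coe,
    LinearEquiv.coe_coe, this]
  rfl

/-- The raising operator `k⁺(φ) : 𝒟 → 𝒟`. -/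
def kPlus [StandardBorelSpace E] (φ : BddMeasurable E) : Module.End ℂ (dom p α) :=
  descend p α (raiseLin p φ) (raise_ker p α φ)

/-- The lowering operator `k⁻(φ) : 𝒟 → 𝒟`. -/
def kMinus (φ : BddMeasurable E) : Module.End ℂ (dom p α) :=
  descend p α (lowerLin p α φ) (lower_ker p α φ)

/-- The operator `(1 / i) (ξ k⁺(1) - conj ξ k⁻(1)) : 𝒟 → 𝒟`. -/
def fieldEnd [StandardBorelSpace E] (ξ : ℂ) : Module.End ℂ (dom p α) :=
  (1 / Complex.I) • (ξ • kPlus p α (one E) - conj ξ • kMinus p α (one E))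

/-- The same operator, as an unbounded operator in `L²(ρ_{p, α})` with domain `𝒟`. -/
def fieldOp [StandardBorelSpace E] (ξ : ℂ) : Hilb p α →ₗ.[ℂ] Hilb p α where
  domain := dom p α
  toFun := (dom p α).subtype ∘ₗ fieldEnd p α ξ

end Operators

end Pascal

end

/-!
The operators `k⁺(φ)` and `k⁻(φ)` are formally adjoint by the Mecke equation for `ρ_{p, α}`, so `A`
is symmetric. They shift the particle number `η(E)` by one, and on functions supported by
configurations with at most `n` points their norms are `O(n)`. Hence `‖Aⁿ F‖` grows at most like
`Kⁿ n!`, which makes every vector of `𝒟` analytic. Let `X_N` be the multiplication by a function of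
the particle number which decreases linearly from `1` to `0` between `N + 1` and `2 (N + 1)` points.
Its increments are of size `1 / (N + 1)`, so that the commutators `[A, X_N]` are bounded uniformly
in `N`. This suffices to approximate every element of the graph of the adjoint of `A` by elements of
the graph of `A`.
-/

section Friedrichs

open Filter Topology

variable {𝕜 ι V H : Type*} [RCLike 𝕜] [AddCommGroup V] [Module 𝕜 V] [NormedAddCommGroup H]
  [InnerProductSpace 𝕜 H] {l : Filter ι} {j : V →ₗ[𝕜] H} {a : V →ₗ[𝕜] V}

/-- A Friedrichs mollifier for the operator `j v ↦ j (a v)` with domain the range of `j`, along the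
filter `l`: symmetric, uniformly bounded operators `X i` converging strongly to the identity, also
in the graph norm, such that every `a ∘ X i` is bounded and the commutators of `a` with the `X i`
are uniformly bounded. Boundedness is measured through `j`, which need not be injective. -/
structure IsFriedrichsMollifier (l : Filter ι) (j : V →ₗ[𝕜] H) (a : V →ₗ[𝕜] V)
    (X : ι → V →ₗ[𝕜] V) : Prop where
  symmetric : ∀ i u v, inner 𝕜 (j (X i u)) (j v) = inner 𝕜 (j u) (j (X i v))
  bounded : ∃ C, ∀ i v, ‖j (X i v)‖ ≤ C * ‖j v‖
  comp_bounded : ∀ i, ∃ C, ∀ v, ‖j (a (X i v))‖ ≤ C * ‖j v‖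
  commutator_bounded : ∃ C, ∀ i v, ‖j (a (X i v) - X i (a v))‖ ≤ C * ‖j v‖
  tendsto : ∀ v, Tendsto (fun i => j (X i v)) l (𝓝 (j v))
  tendsto_apply : ∀ v, Tendsto (fun i => j (a (X i v))) l (𝓝 (j (a v)))

variable [CompleteSpace H]

theorem tendsto_extendOfNorm (hj : DenseRange j) {f : ι → V →ₗ[𝕜] H} {C : ℝ}
    (hf : ∀ i v, ‖f i v‖ ≤ C * ‖j v‖) {S : H →L[𝕜] H}
    (hS : ∀ v, Tendsto (fun i => f i v) l (𝓝 (S (j v)))) (x : H) :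
    Tendsto (fun i => (f i).extendOfNorm j x) l (𝓝 (S x)) := by
  have hbdd : ∃ C, ∀ i x, ‖(f i).extendOfNorm j x‖ ≤ C * ‖x‖ :=
    ⟨C, fun i x => LinearMap.norm_extendOfNorm_apply_le hj C (hf i) x⟩
  have hequi := ((NormedSpace.equicontinuous_TFAE fun i => (f i).extendOfNorm j).out 3 1).1 hbdd
  refine hj.induction_on x (hequi.isClosed_setOfPred_tendsto S.continuous) fun v => ?_
  simpa only [LinearMap.extendOfNorm_eq hj ⟨C, hf _⟩] using hS v

theorem inner_extendOfNorm (hj : DenseRange j) {f : V →ₗ[𝕜] H} (hf : ∃ C, ∀ v, ‖f v‖ ≤ C * ‖j v‖)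
    {y z : H} (h : ∀ u, inner 𝕜 (f u) y = inner 𝕜 (j u) z) (x : H) :
    inner 𝕜 (f.extendOfNorm j x) y = inner 𝕜 x z := by
  refine hj.induction_on x (isClosed_eq (by fun_prop) (by fun_prop)) fun u => ?_
  rw [LinearMap.extendOfNorm_eq hj hf, h u]

theorem IsFriedrichsMollifier.mem_closure_graph [l.NeBot] {X : ι → V →ₗ[𝕜] V}
    (hX : IsFriedrichsMollifier l j a X) (hj : DenseRange j)
    (ha : ∀ u v, inner 𝕜 (j (a u)) (j v) = inner 𝕜 (j u) (j (a v)))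
    {g h : H} (hgh : ∀ v, inner 𝕜 h (j v) = inner 𝕜 g (j (a v))) :
    (g, h) ∈ (LinearMap.range (j.prod (j ∘ₗ a))).topologicalClosure := by
  obtain ⟨Cx, hCx⟩ := hX.bounded
  obtain ⟨Ck, hCk⟩ := hX.commutator_bounded
  let x i := (j ∘ₗ X i).extendOfNorm j
  let b i := (j ∘ₗ a ∘ₗ X i).extendOfNorm j
  let k i := (j ∘ₗ (a ∘ₗ X i - X i ∘ₗ a)).extendOfNorm j
  have hx : ∀ z, Tendsto (fun i => x i z) l (𝓝 z) :=
    tendsto_extendOfNorm (f := fun i => j ∘ₗ X i) (S := .id 𝕜 H) hj hCx hX.tendsto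
  have hk : ∀ z, Tendsto (fun i => k i z) l (𝓝 0) := by
    refine tendsto_extendOfNorm (S := 0) hj hCk fun v => ?_
    simpa using (hX.tendsto_apply v).sub (hX.tendsto (a v))
  -- Moving `a` across the pairing turns `a X g` into `X h`, up to the commutator.
  have hb : ∀ i, b i g = x i h + k i g := fun i => by
    refine hj.eq_of_inner_left 𝕜 fun v => ?_
    have h1 : inner 𝕜 (b i g) (j v) = inner 𝕜 g (j (X i (a v))) :=
      inner_extendOfNorm hj (hX.comp_bounded i) (fun u => by simp [ha, hX.symmetric]) g
    have h2 : inner 𝕜 (x i h) (j v) = inner 𝕜 g (j (a (X i v))) :=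
      (inner_extendOfNorm hj ⟨Cx, hCx i⟩ (fun u => hX.symmetric i u v) h).trans (hgh _)
    have h3 : inner 𝕜 (k i g) (j v) = inner 𝕜 g (j (X i (a v)) - j (a (X i v))) :=
      inner_extendOfNorm hj ⟨Ck, hCk i⟩
        (fun u => by simp [inner_sub_left, inner_sub_right, ha, hX.symmetric]) g
    rw [inner_add_left, h1, h2, h3, inner_sub_right, add_sub_cancel]
  have hmem : ∀ i, (x i g, b i g) ∈ (LinearMap.range (j.prod (j ∘ₗ a))).topologicalClosure := by
    refine fun i => hj.induction_on g (isClosed_closure.preimage (by fun_prop)) fun v =>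
      subset_closure ⟨X i v, Prod.ext ?_ ?_⟩
    exacts [(LinearMap.extendOfNorm_eq (f := j ∘ₗ X i) hj ⟨Cx, hCx i⟩ v).symm,
      (LinearMap.extendOfNorm_eq (f := j ∘ₗ a ∘ₗ X i) hj (hX.comp_bounded i) v).symm]
  have hlim : Tendsto (fun i => (x i g, b i g)) l (𝓝 (g, h)) := by
    simpa only [hb, add_zero] using (hx g).prodMk_nhds ((hx h).add (hk g))
  exact isClosed_closure.mem_of_tendsto hlim (Eventually.of_forall hmem)

theorem isClosable_of_isFormalAdjoint_self {T : H →ₗ.[𝕜] H} (hd : Dense (T.domain : Set H))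
    (hT : T.IsFormalAdjoint T) : T.IsClosable :=
  (LinearPMap.adjoint_isClosed hd).isClosable.leIsClosable (hT.le_adjoint hd)

theorem adjoint_closure_eq {T : H →ₗ.[𝕜] H} (hd : Dense (T.domain : Set H)) (hc : T.IsClosable) :
    T.closure.adjoint = T.adjoint := by
  refine LinearPMap.eq_of_eq_graph ?_
  rw [LinearPMap.adjoint_graph_eq_graph_adjoint (hd.mono T.le_closure.1),
    LinearPMap.adjoint_graph_eq_graph_adjoint hd, ← hc.graph_closure_eq_closure_graph]
  ext ⟨x, y⟩
  simp only [Submodule.mem_adjoint_iff]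
  refine ⟨fun h u v huv => h u v (subset_closure huv), fun h u v huv => ?_⟩
  have hcl : IsClosed {q : H × H | inner 𝕜 q.2 x - inner 𝕜 q.1 y = 0} :=
    isClosed_eq (by fun_prop) continuous_const
  exact closure_minimal (fun q hq => h q.1 q.2 hq) hcl huv

theorem isSelfAdjoint_closure_of_adjoint_graph_le {T : H →ₗ.[𝕜] H}
    (hd : Dense (T.domain : Set H)) (hT : T.IsFormalAdjoint T)
    (hle : T.adjoint.graph ≤ T.graph.topologicalClosure) : IsSelfAdjoint T.closure := by
  have hc := isClosable_of_isFormalAdjoint_self hd hT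
  rw [LinearPMap.isSelfAdjoint_def, adjoint_closure_eq hd hc]
  refine LinearPMap.eq_of_eq_graph ?_
  rw [← hc.graph_closure_eq_closure_graph]
  exact le_antisymm hle (Submodule.topologicalClosure_minimal _
    (LinearPMap.le_graph_of_le (hT.le_adjoint hd)) (LinearPMap.adjoint_isClosed hd))

theorem IsFriedrichsMollifier.isSelfAdjoint_closure [l.NeBot] {X : ι → V →ₗ[𝕜] V}
    (hX : IsFriedrichsMollifier l j a X) {T : H →ₗ.[𝕜] H} (hd : Dense (T.domain : Set H))
    (hT : T.IsFormalAdjoint T) (hgraph : T.graph = LinearMap.range (j.prod (j ∘ₗ a))) :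
    IsSelfAdjoint T.closure := by
  have hmem : ∀ v, (j v, j (a v)) ∈ T.graph := fun v => hgraph ▸ ⟨v, rfl⟩
  have hj : DenseRange j := hd.mono fun x hx => by
    obtain ⟨y, hy⟩ := LinearPMap.mem_domain_iff.1 hx
    obtain ⟨v, hv⟩ := hgraph ▸ hy
    exact ⟨v, congrArg Prod.fst hv⟩
  have ha : ∀ u v, inner 𝕜 (j (a u)) (j v) = inner 𝕜 (j u) (j (a v)) := fun u v => by
    obtain ⟨x, hx⟩ := (LinearPMap.mem_graph_iff _).1 (hmem u)
    obtain ⟨y, hy⟩ := (LinearPMap.mem_graph_iff _).1 (hmem v)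
    simpa only [hx, hy] using hT x y
  refine isSelfAdjoint_closure_of_adjoint_graph_le hd hT ?_
  rintro ⟨g, h⟩ hgh
  rw [LinearPMap.adjoint_graph_eq_graph_adjoint hd, Submodule.mem_adjoint_iff] at hgh
  rw [hgraph]
  refine hX.mem_closure_graph hj ha fun v => ?_
  rw [← inner_conj_symm, ← inner_conj_symm g, ← sub_eq_zero.1 (hgh _ _ (hmem v))]

end Friedrichs

noncomputable section

namespace Pascal

variable {E : Type*} [MeasurableSpace E]

namespace Config

/-- The particle number: the total number of points of a configuration. -/
abbrev num (η : Config E) : ℕ := cnt Set.univ η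

theorem measurable_num : Measurable (num : Config E → ℕ) := measurable_cnt MeasurableSet.univ

theorem cast_num (η : Config E) : (η.num : ℝ≥0∞) = η.toMeasure Set.univ :=
  cast_cnt MeasurableSet.univ η

theorem num_add (η : Config E) (x : E) : (η.add x).num = η.num + 1 := by
  simp [num, cnt_add MeasurableSet.univ]

theorem num_le_iff {η : Config E} {m : ℕ} : η.num ≤ m ↔ η.toMeasure Set.univ ≤ m := by
  rw [← cast_num, Nat.cast_le]

theorem num_remove_ae [StandardBorelSpace E] (η : Config E) :
    ∀ᵐ x ∂η.toMeasure, η.num = (η.remove x).num + 1 := by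
  filter_upwards [removeAux_ae η] with x hx
  conv_lhs => rw [← hx.2, num_add]

end Config

section Mecke

variable {p : ℝ} {α : Measure E} {ρ : Measure (Config E)}

theorem IsMecke.compProd_kernel_eq [SFinite α] [SFinite ρ] (hM : IsMecke p α ρ) :
    ρ.compProd (Config.kernel E) = ENNReal.ofReal p •
      (ρ.compProd (Kernel.const _ α + Config.kernel E)).map fun q => (q.1.add q.2, q.2) := by
  have hadd : Measurable fun q : Config E × E => (q.1.add q.2, q.2) :=
    Config.measurable_add.prodMk measurable_snd
  refine Measure.ext fun S hS => ?_
  have hind : Measurable (S.indicator (1 : Config E × E → ℝ≥0∞)) := measurable_one.indicator hS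
  rw [← lintegral_indicator_one hS, ← lintegral_indicator_one hS, lintegral_smul_measure,
    lintegral_map hind hadd, Measure.lintegral_compProd hind,
    Measure.lintegral_compProd
      (f := fun q : Config E × E => S.indicator 1 (q.1.add q.2, q.2)) (hind.comp hadd)]
  exact hM _ hind

theorem IsMecke.integral_eq [SFinite α] [SFinite ρ] (hp : 0 < p) (hM : IsMecke p α ρ)
    {K : Config E × E → ℂ} (hK : Integrable K (ρ.compProd (Config.kernel E))) :
    ∫ η, ∫ x, K (η, x) ∂η.toMeasure ∂ρ =
      p * ∫ η, ∫ x, K (η.add x, x) ∂(α + η.toMeasure) ∂ρ := by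
  have hadd : Measurable fun q : Config E × E => (q.1.add q.2, q.2) :=
    Config.measurable_add.prodMk measurable_snd
  have hKmap : Integrable K
      ((ρ.compProd (Kernel.const _ α + Config.kernel E)).map fun q => (q.1.add q.2, q.2)) := by
    rwa [hM.compProd_kernel_eq, integrable_smul_measure (by simpa using hp)
      ENNReal.ofReal_ne_top] at hK
  have hleft := Measure.integral_compProd hK
  have hright := Measure.integral_compProd (hKmap.comp_measurable hadd)
  rw [hM.compProd_kernel_eq, integral_smul_measure, ENNReal.toReal_ofReal hp.le,
    integral_map hadd.aemeasurable hKmap.aestronglyMeasurable, Complex.real_smul] at hleft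
  exact hleft.symm.trans (congrArg _ hright)

theorem integrable_compProd_kernel [IsFiniteMeasure ρ] {K : Config E × E → ℂ} (hK : Measurable K)
    {C : ℝ} (hC : ∀ q, ‖K q‖ ≤ C) {m : ℕ} (hm : ∀ q, K q ≠ 0 → q.1.num ≤ m) :
    Integrable K (ρ.compProd (Config.kernel E)) := by
  let S : Set (Config E × E) := {q | q.1.num ≤ m}
  have hS : MeasurableSet S := (Config.measurable_num.comp measurable_fst) measurableSet_Iic
  have hle : ∀ η : Config E, Config.kernel E η (Prod.mk η ⁻¹' S) ≤ m := fun η => by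
    by_cases h : η.num ≤ m
    · exact (measure_mono (Set.subset_univ _)).trans (Config.num_le_iff.1 h)
    · simp [S, h]
  have hfin : ρ.compProd (Config.kernel E) S ≠ ∞ := by
    rw [Measure.compProd_apply hS]
    refine ((lintegral_mono hle).trans_lt ?_).ne
    rw [lintegral_const]
    exact ENNReal.mul_lt_top (ENNReal.natCast_lt_top m) (measure_lt_top ρ _)
  refine (integrableOn_iff_integrable_of_support_subset hm).1 ?_
  exact Measure.integrableOn_of_bounded hfin hK.aestronglyMeasurable (.of_forall hC)

/-- Away from the empty configuration this is the Mecke equation for `f η / η(E)`. -/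
theorem IsMecke.lintegral_add_div_le (hM : IsMecke p α ρ) {f : Config E → ℝ≥0∞}
    (hf : Measurable f) :
    ENNReal.ofReal p * ∫⁻ η, (∫⁻ x, f (η.add x) ∂(α + η.toMeasure)) / (η.num + 1) ∂ρ ≤
      ∫⁻ η, f η ∂ρ := by
  have hnum : Measurable fun η : Config E => (η.num : ℝ≥0∞) :=
    (measurable_of_countable _).comp Config.measurable_num
  have h := hM (fun q => f q.1 / q.1.num) ((hf.div hnum).comp measurable_fst)
  calc _ = ∫⁻ η, ∫⁻ _, f η / η.num ∂η.toMeasure ∂ρ := by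
        rw [h]
        congr 1
        refine lintegral_congr fun η => ?_
        have hadd : Measurable fun x => f (η.add x) :=
          hf.comp (Config.measurable_add.comp measurable_prodMk_left)
        simp only [Config.num_add, Nat.cast_add, Nat.cast_one, div_eq_mul_inv,
          lintegral_mul_const _ hadd]
    _ ≤ ∫⁻ η, f η ∂ρ := lintegral_mono fun η => by
        rw [lintegral_const, ← Config.cast_num, mul_comm]
        exact ENNReal.mul_div_le

end Mecke

section Weight

/-- `VanishesAbove m F` says that `F` is supported by the configurations with at most `m` points;
every element of `cutoffFun E` has such a bound. -/
def VanishesAbove (m : ℕ) (F : cutoffFun E) : Prop :=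
  ∀ η, F.1 η ≠ 0 → η.num ≤ m

theorem exists_vanishesAbove (F : cutoffFun E) : ∃ m, VanishesAbove m F := by
  obtain ⟨m, hm⟩ := F.2.2.2
  exact ⟨m, fun η h => Config.num_le_iff.2 (hm η h)⟩

theorem weight_mem (w : ℕ → ℝ) (F : cutoffFun E) :
    (fun η => (w η.num : ℂ) * F.1 η) ∈ cutoffFun E := by
  obtain ⟨m, hm⟩ := exists_vanishesAbove F
  obtain ⟨hF, ⟨C, hC⟩, hcut⟩ := F.2
  have hw : Measurable fun η : Config E => (w η.num : ℂ) :=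
    Complex.measurable_ofReal.comp ((measurable_of_countable w).comp Config.measurable_num)
  obtain ⟨c, hc⟩ := ((Set.finite_Iic m).image fun n => |w n|).bddAbove
  refine ⟨hw.mul hF, ⟨|c| * |C|, fun η => ?_⟩,
    hcut.imp fun k hk η h => hk η (right_ne_zero_of_mul h)⟩
  by_cases h0 : F.1 η = 0
  · simp only [h0, mul_zero, norm_zero]
    positivity
  · rw [norm_mul, Complex.norm_real, Real.norm_eq_abs]
    exact mul_le_mul ((hc ⟨_, hm η h0, rfl⟩).trans (le_abs_self c))
      ((hC η).trans (le_abs_self C)) (norm_nonneg _) (abs_nonneg c)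

/-- Multiplication by a real function of the particle number. -/
def weight (w : ℕ → ℝ) : cutoffFun E →ₗ[ℂ] cutoffFun E where
  toFun F := ⟨fun η => (w η.num : ℂ) * F.1 η, weight_mem w F⟩
  map_add' F G := by ext η; simp [mul_add]
  map_smul' c F := by ext η; simp [mul_left_comm]

theorem weight_apply (w : ℕ → ℝ) (F : cutoffFun E) (η : Config E) :
    (weight w F).1 η = (w η.num : ℂ) * F.1 η := rfl

theorem weight_sub (v w : ℕ → ℝ) (F : cutoffFun E) :
    weight (fun n => v n - w n) F = weight v F - weight w F := by
  ext η
  simp [weight_apply, sub_mul]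

theorem vanishesAbove_weight {w : ℕ → ℝ} {m : ℕ} (hw : ∀ n, m < n → w n = 0) (F : cutoffFun E) :
    VanishesAbove m (weight w F) := by
  intro η hη
  by_contra! hlt
  exact hη (by simp [weight_apply, hw _ hlt])

theorem VanishesAbove.weight_eq_self {m : ℕ} {F : cutoffFun E} (hF : VanishesAbove m F)
    {w : ℕ → ℝ} (hw : ∀ n ≤ m, w n = 1) : weight w F = F := by
  ext η
  by_cases h0 : F.1 η = 0
  · simp [weight_apply, h0]
  · simp [weight_apply, hw _ (hF η h0)]

theorem weight_raiseLin [StandardBorelSpace E] (p : ℝ) (φ : BddMeasurable E) (w : ℕ → ℝ)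
    (F : cutoffFun E) :
    weight w (raiseLin p φ F) = raiseLin p φ (weight (fun n => w (n + 1)) F) := by
  ext η
  change _ * raiseFun p φ.1 F.1 η = raiseFun p φ.1 _ η
  rw [raiseFun, raiseFun, mul_left_comm]
  congr 1
  rw [← integral_const_mul]
  refine integral_congr_ae ?_
  filter_upwards [η.num_remove_ae] with x hx
  rw [weight_apply, hx]
  ring

theorem lowerLin_weight (p : ℝ) (α : Measure E) [IsFiniteMeasure α] (φ : BddMeasurable E)
    (w : ℕ → ℝ) (F : cutoffFun E) :
    lowerLin p α φ (weight w F) = weight (fun n => w (n + 1)) (lowerLin p α φ F) := by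
  ext η
  change lowerFun p α φ.1 _ η = _ * lowerFun p α φ.1 F.1 η
  rw [lowerFun, lowerFun, mul_left_comm]
  congr 1
  rw [← integral_const_mul]
  refine integral_congr_ae (ae_of_all _ fun x => ?_)
  simp only [weight_apply, Config.num_add]
  ring

theorem VanishesAbove.raiseLin [StandardBorelSpace E] {m : ℕ} {F : cutoffFun E}
    (hF : VanishesAbove m F) (p : ℝ) (φ : BddMeasurable E) :
    VanishesAbove (m + 1) (raiseLin p φ F) := by
  let w : ℕ → ℝ := fun n => if n ≤ m + 1 then 1 else 0
  have h : weight w (Pascal.raiseLin p φ F) = Pascal.raiseLin p φ F := by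
    rw [weight_raiseLin, hF.weight_eq_self fun n hn => if_pos (by lia)]
  exact h ▸ vanishesAbove_weight (fun n hn => if_neg (by lia)) _

theorem VanishesAbove.lowerLin {m : ℕ} {F : cutoffFun E} (hF : VanishesAbove m F) (p : ℝ)
    (α : Measure E) [IsFiniteMeasure α] (φ : BddMeasurable E) :
    VanishesAbove m (lowerLin p α φ F) := by
  let w : ℕ → ℝ := fun n => if n ≤ m then 1 else 0
  have h : weight (fun n => w (n + 1)) (Pascal.lowerLin p α φ F) = Pascal.lowerLin p α φ F := by
    rw [← lowerLin_weight, hF.weight_eq_self fun n hn => if_pos hn]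
  exact h ▸ vanishesAbove_weight (fun n hn => if_neg (by lia)) _

end Weight

section Adjointness

variable (p : Set.Ioo (0 : ℝ) 1) (α : Measure E) [IsFiniteMeasure α]

theorem toL2_coeFn (F : cutoffFun E) : toL2 p α F =ᵐ[pascalLaw p α] F.1 :=
  (memLp_cutoffFun p α F).coeFn_toLp

theorem inner_toL2 (F G : cutoffFun E) :
    inner ℂ (toL2 p α F) (toL2 p α G) = ∫ η, conj (F.1 η) * G.1 η ∂pascalLaw p α := by
  rw [L2.inner_def]
  refine integral_congr_ae ?_
  filter_upwards [toL2_coeFn p α F, toL2_coeFn p α G] with η hF hG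
  rw [hF, hG, RCLike.inner_apply, mul_comm]

theorem inner_weight (w : ℕ → ℝ) (F G : cutoffFun E) :
    inner ℂ (toL2 p α (weight w F)) (toL2 p α G) =
      inner ℂ (toL2 p α F) (toL2 p α (weight w G)) := by
  rw [inner_toL2, inner_toL2]
  congr 1 with η
  simp only [weight_apply, map_mul, Complex.conj_ofReal]
  ring

theorem removeAux_add [MeasurableSingletonClass E] (η : Config E) (x : E) :
    removeAux (η.add x, x) = η := by
  simp [removeAux, Config.remove_add]

variable [StandardBorelSpace E]

theorem integrable_mecke_pairing (φ : BddMeasurable E) (F G : cutoffFun E) :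
    Integrable (fun q : Config E × E => conj (φ.1 q.2 * F.1 (removeAux q)) * G.1 q.1)
      ((pascalLaw p α).compProd (Config.kernel E)) := by
  obtain ⟨φ, hφ, D, hD⟩ := φ
  obtain ⟨m, hm⟩ := exists_vanishesAbove G
  obtain ⟨hF, ⟨C, hC⟩, -⟩ := F.2
  obtain ⟨hG, ⟨C', hC'⟩, -⟩ := G.2
  have hK : Measurable fun q : Config E × E => conj (φ q.2 * F.1 (removeAux q)) * G.1 q.1 :=
    (Complex.continuous_conj.measurable.comp
      ((hφ.comp measurable_snd).mul (hF.comp measurable_removeAux))).mul (hG.comp measurable_fst)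
  refine integrable_compProd_kernel hK (C := |D| * |C| * |C'|) (fun q => ?_)
    fun q h => hm q.1 (right_ne_zero_of_mul h)
  rw [norm_mul, RCLike.norm_conj, norm_mul]
  gcongr
  exacts [(hD _).trans (le_abs_self D), (hC _).trans (le_abs_self C),
    (hC' _).trans (le_abs_self C')]

theorem inner_raiseLin (φ : BddMeasurable E) (F G : cutoffFun E) :
    inner ℂ (toL2 p α (raiseLin p φ F)) (toL2 p α G) =
      inner ℂ (toL2 p α F) (toL2 p α (lowerLin p α φ G)) := by
  have hp : (0 : ℝ) < p := p.2.1
  let K : Config E × E → ℂ := fun q => conj (φ.1 q.2 * F.1 (removeAux q)) * G.1 q.1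
  have hraise : ∀ η, conj ((raiseLin p φ F).1 η) * G.1 η =
      (1 / √p : ℝ) * ∫ x, K (η, x) ∂η.toMeasure := fun η => by
    change conj (raiseFun p φ.1 F.1 η) * G.1 η = _
    rw [raiseFun, raise_integral_eq, map_mul, Complex.conj_ofReal, ← integral_conj, mul_assoc,
      ← integral_mul_const]
  have hlower : ∀ η, conj (F.1 η) * (lowerLin p α φ G).1 η =
      √p * ∫ x, K (η.add x, x) ∂(α + η.toMeasure) := fun η => by
    change conj (F.1 η) * lowerFun p α φ.1 G.1 η = _
    rw [lowerFun, mul_left_comm, ← integral_const_mul]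
    congr 2 with x
    simp only [K, removeAux_add, map_mul]
    ring
  have hsqrt : 1 / √(p : ℝ) * p = √p := by
    rw [one_div_mul_eq_div, Real.div_sqrt]
  simp only [inner_toL2, hraise, hlower, integral_const_mul]
  rw [(isMecke_pascalLaw p α).integral_eq hp (integrable_mecke_pairing p α φ F G), ← mul_assoc,
    ← Complex.ofReal_mul, hsqrt]

theorem inner_lowerLin (φ : BddMeasurable E) (F G : cutoffFun E) :
    inner ℂ (toL2 p α (lowerLin p α φ F)) (toL2 p α G) =
      inner ℂ (toL2 p α F) (toL2 p α (raiseLin p φ G)) := by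
  rw [← inner_conj_symm, ← inner_raiseLin, inner_conj_symm]

end Adjointness

section Density

variable (p : Set.Ioo (0 : ℝ) 1) (α : Measure E) [IsFiniteMeasure α]

theorem exists_cutoffFun_eq_indicator {g : Config E → ℂ} (hg : Measurable g) (m : ℕ) :
    ∃ F : cutoffFun E, F.1 = {η | η.num ≤ m ∧ ‖g η‖ ≤ m}.indicator g := by
  have hS : MeasurableSet {η : Config E | η.num ≤ m ∧ ‖g η‖ ≤ m} :=
    (Config.measurable_num measurableSet_Iic).inter (hg.norm measurableSet_Iic)
  refine ⟨⟨_, hg.indicator hS, ⟨m, fun η => ?_⟩, m, fun η h => ?_⟩, rfl⟩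
  · rw [norm_indicator_eq_indicator_norm]
    exact Set.indicator_apply_le' (fun h => h.2) fun _ => m.cast_nonneg
  · exact Config.num_le_iff.1 (Set.mem_of_indicator_ne_zero h).1

theorem dense_dom : Dense (dom p α : Set (Hilb p α)) := by
  rw [Submodule.dense_iff_topologicalClosure_eq_top, Submodule.topologicalClosure_eq_top_iff,
    Submodule.eq_bot_iff]
  intro g hg
  have hgm : Measurable g := (Lp.stronglyMeasurable g).measurable
  choose F hF using exists_cutoffFun_eq_indicator hgm
  have hzero : ∀ m, toL2 p α (F m) = 0 := fun m => by
    rw [← inner_self_eq_zero (𝕜 := ℂ), ← hg (toL2 p α (F m)) ⟨F m, rfl⟩,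
      L2.inner_def, L2.inner_def]
    refine integral_congr_ae ?_
    filter_upwards [toL2_coeFn p α (F m)] with η hη
    rw [hη, hF]
    by_cases h : η ∈ {η | η.num ≤ m ∧ ‖g η‖ ≤ m} <;> simp [h]
  rw [Lp.eq_zero_iff_ae_eq_zero]
  filter_upwards [ae_all_iff.2 fun m => (mem_ker_toL2 p α (F m)).1 (hzero m)] with η hη
  obtain ⟨m, hm⟩ := exists_nat_ge ‖g η‖
  have hmem : η ∈ {ζ | ζ.num ≤ max η.num m ∧ ‖g ζ‖ ≤ (max η.num m : ℕ)} :=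
    ⟨le_max_left _ _, hm.trans (by exact_mod_cast le_max_right _ _)⟩
  simpa only [hF, Set.indicator_of_mem hmem] using hη (max η.num m)

end Density

theorem enorm_integral_sq_le {X : Type*} [MeasurableSpace X] (μ : Measure X) {f : X → ℂ}
    (hf : AEStronglyMeasurable f μ) :
    ‖∫ x, f x ∂μ‖ₑ ^ 2 ≤ μ Set.univ * ∫⁻ x, ‖f x‖ₑ ^ 2 ∂μ := by
  have hholder := ENNReal.lintegral_mul_le_Lp_mul_Lq μ Real.HolderConjugate.two_two
    (f := fun _ => 1) (g := fun x => ‖f x‖ₑ) aemeasurable_const hf.enorm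
  have hsqrt : ∀ t : ℝ≥0∞, (t ^ (1 / 2 : ℝ)) ^ 2 = t := fun t => by
    rw [← ENNReal.rpow_natCast, ← ENNReal.rpow_mul]
    norm_num
  calc ‖∫ x, f x ∂μ‖ₑ ^ 2
      ≤ (μ Set.univ ^ (1 / 2 : ℝ) * (∫⁻ x, ‖f x‖ₑ ^ 2 ∂μ) ^ (1 / 2 : ℝ)) ^ 2 := by
        gcongr
        refine (enorm_integral_le_lintegral_enorm f).trans ?_
        simpa using hholder
    _ = μ Set.univ * ∫⁻ x, ‖f x‖ₑ ^ 2 ∂μ := by rw [mul_pow, hsqrt, hsqrt]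

section Estimates

variable (p : Set.Ioo (0 : ℝ) 1) (α : Measure E) [IsFiniteMeasure α]

theorem norm_weight_le {w : ℕ → ℝ} {c : ℝ} (hw : ∀ n, |w n| ≤ c) (F : cutoffFun E) :
    ‖toL2 p α (weight w F)‖ ≤ c * ‖toL2 p α F‖ := by
  refine Lp.norm_le_mul_norm_of_ae_le_mul ?_
  filter_upwards [toL2_coeFn p α F, toL2_coeFn p α (weight w F)] with η hF hwF
  rw [hF, hwF, weight_apply, norm_mul, Complex.norm_real, Real.norm_eq_abs]
  gcongr
  exact hw η.num

theorem enorm_toL2_sq (F : cutoffFun E) :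
    ‖toL2 p α F‖ₑ ^ 2 = ∫⁻ η, ‖F.1 η‖ₑ ^ 2 ∂pascalLaw p α := by
  change ‖(memLp_cutoffFun p α F).toLp F.1‖ₑ ^ 2 = _
  rw [Lp.enorm_toLp]
  simpa using eLpNorm_nnreal_pow_eq_lintegral (p := 2) (μ := pascalLaw p α) (f := F.1) (by simp)

theorem norm_toL2_le_of_lintegral_le {F G : cutoffFun E} {c : ℝ} (hc : 0 ≤ c)
    (h : ∫⁻ η, ‖F.1 η‖ₑ ^ 2 ∂pascalLaw p α ≤
      ENNReal.ofReal (c ^ 2) * ∫⁻ η, ‖G.1 η‖ₑ ^ 2 ∂pascalLaw p α) :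
    ‖toL2 p α F‖ ≤ c * ‖toL2 p α G‖ := by
  rw [← enorm_toL2_sq, ← enorm_toL2_sq, ← ofReal_norm, ← ofReal_norm,
    ← ENNReal.ofReal_pow (norm_nonneg _), ← ENNReal.ofReal_pow (norm_nonneg _),
    ← ENNReal.ofReal_mul (by positivity), ENNReal.ofReal_le_ofReal_iff (by positivity),
    ← mul_pow] at h
  exact le_of_sq_le_sq h (by positivity)

variable {φ : BddMeasurable E} {D : ℝ} {w : ℕ → ℝ} {c : ℝ}

theorem enorm_lowerLin_sq_le (hD : ∀ x, ‖φ.1 x‖ ≤ D) (F : cutoffFun E) (η : Config E) :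
    ‖(lowerLin p α φ F).1 η‖ₑ ^ 2 ≤ ENNReal.ofReal (p * D ^ 2 * (α.real Set.univ + η.num)) *
      ∫⁻ x, ‖F.1 (η.add x)‖ₑ ^ 2 ∂(α + η.toMeasure) := by
  have hp : (0 : ℝ) < p := p.2.1
  have hF : Measurable fun x => F.1 (η.add x) :=
    F.2.1.comp (Config.measurable_add.comp measurable_prodMk_left)
  have hmass : (α + η.toMeasure) Set.univ = ENNReal.ofReal (α.real Set.univ + η.num) := by
    rw [Measure.add_apply, ← Config.cast_num,
      ENNReal.ofReal_add measureReal_nonneg (by positivity), ofReal_measureReal,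
      ENNReal.ofReal_natCast]
  have hle : ∀ x, ‖conj (φ.1 x) * F.1 (η.add x)‖ₑ ^ 2 ≤
      ENNReal.ofReal (D ^ 2) * ‖F.1 (η.add x)‖ₑ ^ 2 := fun x => by
    rw [enorm_mul, mul_pow, RCLike.enorm_conj, ← ofReal_norm (φ.1 x),
      ← ENNReal.ofReal_pow (norm_nonneg _)]
    gcongr
    exact hD x
  have hsqrt : ‖((√p : ℝ) : ℂ)‖ₑ ^ 2 = ENNReal.ofReal p := by
    rw [← ofReal_norm, Complex.norm_real, ← ENNReal.ofReal_pow (norm_nonneg _),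
      Real.norm_eq_abs, sq_abs, Real.sq_sqrt hp.le]
  calc ‖lowerFun p α φ.1 F.1 η‖ₑ ^ 2
      = ENNReal.ofReal p * ‖∫ x, conj (φ.1 x) * F.1 (η.add x) ∂(α + η.toMeasure)‖ₑ ^ 2 := by
        rw [lowerFun, enorm_mul, mul_pow, hsqrt]
    _ ≤ ENNReal.ofReal p * ((α + η.toMeasure) Set.univ *
          ∫⁻ x, ‖conj (φ.1 x) * F.1 (η.add x)‖ₑ ^ 2 ∂(α + η.toMeasure)) := by
        gcongr
        exact enorm_integral_sq_le _
          ((Complex.continuous_conj.measurable.comp φ.2.1).mul hF).aestronglyMeasurable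
    _ ≤ ENNReal.ofReal p * (ENNReal.ofReal (α.real Set.univ + η.num) *
          (ENNReal.ofReal (D ^ 2) * ∫⁻ x, ‖F.1 (η.add x)‖ₑ ^ 2 ∂(α + η.toMeasure))) := by
        rw [hmass, ← lintegral_const_mul' (ENNReal.ofReal (D ^ 2)) _ ENNReal.ofReal_ne_top]
        gcongr
        exact hle _
    _ = _ := by
        rw [ENNReal.ofReal_mul (by positivity), ENNReal.ofReal_mul hp.le]
        ring

theorem enorm_weight_lowerLin_sq_le (hD : ∀ x, ‖φ.1 x‖ ≤ D)
    (hw : ∀ n, |w n| * (α.real Set.univ + n + 1) ≤ c) (F : cutoffFun E) (η : Config E) :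
    ‖(weight w (lowerLin p α φ F)).1 η‖ₑ ^ 2 ≤ ENNReal.ofReal ((D * c) ^ 2) *
      (ENNReal.ofReal p *
        ((∫⁻ x, ‖F.1 (η.add x)‖ₑ ^ 2 ∂(α + η.toMeasure)) / (η.num + 1))) := by
  have hp : (0 : ℝ) < p := p.2.1
  set a := α.real Set.univ
  have ha : 0 ≤ a := measureReal_nonneg
  set n := η.num
  set I := ∫⁻ x, ‖F.1 (η.add x)‖ₑ ^ 2 ∂(α + η.toMeasure)
  have hwn : w n ^ 2 * (a + n) * (n + 1) ≤ c ^ 2 := by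
    calc w n ^ 2 * (a + n) * (n + 1)
        ≤ |w n| ^ 2 * (a + n + 1) * (a + n + 1) := by
          rw [sq_abs]
          gcongr w n ^ 2 * ?_ * ?_ <;> linarith
      _ = (|w n| * (a + n + 1)) ^ 2 := by ring
      _ ≤ c ^ 2 := by gcongr; exact hw n
  have hcoeff : w n ^ 2 * (p * D ^ 2 * (a + n)) ≤ (D * c) ^ 2 * (p * ((n : ℝ) + 1)⁻¹) := by
    rw [← div_eq_mul_inv, ← mul_div_assoc, le_div_iff₀ (by positivity)]
    calc w n ^ 2 * (p * D ^ 2 * (a + n)) * (n + 1)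
        = p * D ^ 2 * (w n ^ 2 * (a + n) * (n + 1)) := by ring
      _ ≤ p * D ^ 2 * c ^ 2 := by gcongr
      _ = (D * c) ^ 2 * p := by ring
  have hinv : ((n : ℝ≥0∞) + 1)⁻¹ = ENNReal.ofReal ((n : ℝ) + 1)⁻¹ := by
    rw [ENNReal.ofReal_inv_of_pos (by positivity), ENNReal.ofReal_add (by positivity) zero_le_one,
      ENNReal.ofReal_natCast, ENNReal.ofReal_one]
  calc ‖(weight w (lowerLin p α φ F)).1 η‖ₑ ^ 2
      = ENNReal.ofReal (w n ^ 2) * ‖(lowerLin p α φ F).1 η‖ₑ ^ 2 := by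
        rw [weight_apply, enorm_mul, mul_pow, ← ofReal_norm, Complex.norm_real,
          ← ENNReal.ofReal_pow (norm_nonneg _), Real.norm_eq_abs, sq_abs]
    _ ≤ ENNReal.ofReal (w n ^ 2) * (ENNReal.ofReal (p * D ^ 2 * (a + n)) * I) := by
        gcongr
        exact enorm_lowerLin_sq_le p α hD F η
    _ ≤ ENNReal.ofReal ((D * c) ^ 2 * (p * ((n : ℝ) + 1)⁻¹)) * I := by
        rw [← mul_assoc, ← ENNReal.ofReal_mul (sq_nonneg _)]
        gcongr
    _ = ENNReal.ofReal ((D * c) ^ 2) * (ENNReal.ofReal p * (I / (n + 1))) := by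
        rw [ENNReal.ofReal_mul (sq_nonneg _), ENNReal.ofReal_mul hp.le, div_eq_mul_inv, hinv]
        ring

theorem norm_weight_lowerLin_le (hD0 : 0 ≤ D) (hD : ∀ x, ‖φ.1 x‖ ≤ D)
    (hw : ∀ n, |w n| * (α.real Set.univ + n + 1) ≤ c) (F : cutoffFun E) :
    ‖toL2 p α (weight w (lowerLin p α φ F))‖ ≤ D * c * ‖toL2 p α F‖ := by
  have hc : 0 ≤ c := le_trans (by positivity) (hw 0)
  refine norm_toL2_le_of_lintegral_le p α (by positivity) ?_
  refine (lintegral_mono (enorm_weight_lowerLin_sq_le p α hD hw F)).trans ?_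
  rw [lintegral_const_mul' _ _ ENNReal.ofReal_ne_top,
    lintegral_const_mul' _ _ ENNReal.ofReal_ne_top]
  gcongr
  exact (isMecke_pascalLaw p α).lintegral_add_div_le (F.2.1.enorm.pow_const 2)

variable [StandardBorelSpace E]

theorem norm_raiseLin_weight_le (hD0 : 0 ≤ D) (hD : ∀ x, ‖φ.1 x‖ ≤ D)
    (hw : ∀ n, |w n| * (α.real Set.univ + n + 1) ≤ c) (F : cutoffFun E) :
    ‖toL2 p α (raiseLin p φ (weight w F))‖ ≤ D * c * ‖toL2 p α F‖ := by
  have hc : 0 ≤ c := le_trans (by positivity) (hw 0)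
  set G := raiseLin p φ (weight w F)
  have hG : ‖toL2 p α G‖ ^ 2 ≤ ‖toL2 p α F‖ * (D * c * ‖toL2 p α G‖) := by
    calc ‖toL2 p α G‖ ^ 2 = ‖inner ℂ (toL2 p α F) (toL2 p α (weight w (lowerLin p α φ G)))‖ := by
          rw [← inner_weight, ← inner_raiseLin, inner_self_eq_norm_sq_to_K, norm_pow,
            RCLike.norm_ofReal, abs_norm]
      _ ≤ ‖toL2 p α F‖ * ‖toL2 p α (weight w (lowerLin p α φ G))‖ := norm_inner_le_norm _ _
      _ ≤ _ := by
        gcongr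
        exact norm_weight_lowerLin_le p α hD0 hD hw G
  rcases (norm_nonneg (toL2 p α G)).eq_or_lt with h0 | hpos
  · rw [← h0]
    exact mul_nonneg (mul_nonneg hD0 hc) (norm_nonneg _)
  · refine le_of_mul_le_mul_right ?_ hpos
    linarith

end Estimates

section Ramp

/-- A cutoff of the particle number: `1` up to `N + 1`, then affine, then `0` from `2 * (N + 1)` on,
where the subtraction in `ℕ` truncates. -/
def ramp (N n : ℕ) : ℝ := (min (N + 1) (2 * (N + 1) - n) : ℕ) / (N + 1)

theorem ramp_eq_one {N n : ℕ} (h : n ≤ N + 1) : ramp N n = 1 := by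
  rw [ramp, min_eq_left (by lia), Nat.cast_succ, div_self (by positivity)]

theorem ramp_eq_zero {N n : ℕ} (h : 2 * (N + 1) ≤ n) : ramp N n = 0 := by
  rw [ramp, Nat.sub_eq_zero_of_le h, Nat.min_zero, Nat.cast_zero, zero_div]

theorem abs_ramp_le (N n : ℕ) : |ramp N n| ≤ 1 := by
  rw [ramp, abs_of_nonneg (by positivity), div_le_one (by positivity)]
  exact_mod_cast min_le_left _ _

theorem abs_ramp_sub_le (N n : ℕ) : |ramp N n - ramp N (n + 1)| ≤ 1 / (N + 1) := by
  let k : ℕ → ℕ := fun i => min (N + 1) (2 * (N + 1) - i)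
  have hle : k (n + 1) ≤ k n := by dsimp only [k]; lia
  have hge : k n ≤ k (n + 1) + 1 := by dsimp only [k]; lia
  change |(k n : ℝ) / (N + 1) - (k (n + 1) : ℕ) / (N + 1)| ≤ _
  have hge' : (k n : ℝ) ≤ k (n + 1) + 1 := by exact_mod_cast hge
  rw [← sub_div, abs_div, abs_of_nonneg (sub_nonneg.2 (Nat.cast_le.2 hle)),
    abs_of_nonneg (by positivity)]
  gcongr
  linarith

theorem abs_ramp_sub_mul_le {a : ℝ} (ha : 0 ≤ a) (N n : ℕ) :
    |ramp N n - ramp N (n + 1)| * (a + n + 1) ≤ a + 2 := by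
  by_cases hn : 2 * (N + 1) ≤ n
  · rw [ramp_eq_zero hn, ramp_eq_zero (hn.trans n.le_succ), sub_self, abs_zero, zero_mul]
    positivity
  · have hn' : (n : ℝ) + 1 ≤ 2 * (N + 1) := by exact_mod_cast not_le.1 hn
    have hN : 0 ≤ a * N := by positivity
    calc |ramp N n - ramp N (n + 1)| * (a + n + 1)
        ≤ 1 / (N + 1) * ((a + 2) * (N + 1)) := by
          gcongr
          · exact abs_ramp_sub_le N n
          · linarith
      _ = a + 2 := by field_simp

end Ramp

theorem exists_summable_pow_div_factorial_mul {u : ℕ → ℝ} (hu : ∀ n, 0 ≤ u n) {K c : ℝ}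
    (hK : 0 ≤ K) {m : ℕ} (h : ∀ n, u n ≤ K ^ n * (m + 1).ascFactorial n * c) :
    ∃ ε : ℝ, 0 < ε ∧ Summable fun n : ℕ => ε ^ n / n.factorial * u n := by
  have hr : ‖K / (K + 1)‖ < 1 := by
    rw [Real.norm_of_nonneg (by positivity), div_lt_one (by positivity)]
    linarith
  refine ⟨1 / (K + 1), by positivity, Summable.of_nonneg_of_le
    (fun n => mul_nonneg (by positivity) (hu n)) (fun n => ?_)
    ((summable_choose_mul_geometric_of_norm_lt_one m hr).mul_right c)⟩
  have hasc : ((m + 1).ascFactorial n : ℝ) = n.factorial * (n + m).choose m := by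
    rw [Nat.ascFactorial_eq_factorial_mul_choose, Nat.add_comm n m, Nat.choose_symm_add,
      Nat.cast_mul]
  calc (1 / (K + 1)) ^ n / n.factorial * u n
      ≤ (1 / (K + 1)) ^ n / n.factorial * (K ^ n * (m + 1).ascFactorial n * c) := by
        gcongr
        exact h n
    _ = (n + m).choose m * (K / (K + 1)) ^ n * c := by
        rw [hasc, div_pow, div_pow, one_pow]
        field_simp

theorem exists_nonneg_bound (φ : BddMeasurable E) : ∃ D : ℝ, 0 ≤ D ∧ ∀ x, ‖φ.1 x‖ ≤ D := by
  obtain ⟨D, hD⟩ := φ.2.2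
  exact ⟨|D|, abs_nonneg D, fun x => (hD x).trans (le_abs_self D)⟩

section SmearedField

variable (p : Set.Ioo (0 : ℝ) 1) (α : Measure E) [IsFiniteMeasure α] [StandardBorelSpace E]
  (φ : BddMeasurable E)

/-- The operator `(1 / i) (k⁺(φ) - k⁻(φ))` on functions, before passing to classes in `L²`. -/
def fieldLin : cutoffFun E →ₗ[ℂ] cutoffFun E :=
  (1 / Complex.I) • (raiseLin p φ - lowerLin p α φ)

/-- The field operator `(1 / i) (k⁺(φ) - k⁻(φ)) : 𝒟 → 𝒟` smeared with the test function `φ`.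
As `k⁺(φ)` is linear and `k⁻(φ)` antilinear in `φ`, the constant `φ = ξ` gives `fieldEnd p α ξ`. -/
def smearedFieldEnd : Module.End ℂ (dom p α) :=
  (1 / Complex.I) • (kPlus p α φ - kMinus p α φ)

/-- The smeared field operator as an unbounded operator in `L²(ρ_{p, α})` with domain `𝒟`. -/
def smearedFieldOp : Hilb p α →ₗ.[ℂ] Hilb p α where
  domain := dom p α
  toFun := (dom p α).subtype ∘ₗ smearedFieldEnd p α φ

theorem fieldLin_apply (F : cutoffFun E) :
    fieldLin p α φ F = (1 / Complex.I) • (raiseLin p φ F - lowerLin p α φ F) := rfl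

theorem smearedFieldEnd_toL2 (F : cutoffFun E) :
    smearedFieldEnd p α φ ⟨toL2 p α F, F, rfl⟩ =
      ⟨toL2 p α (fieldLin p α φ F), fieldLin p α φ F, rfl⟩ := by
  ext1
  simp only [smearedFieldEnd, LinearMap.smul_apply, LinearMap.sub_apply, kPlus, kMinus,
    descend_apply, fieldLin_apply, map_smul, map_sub, Submodule.coe_smul, AddSubgroupClass.coe_sub]

theorem smearedFieldEnd_pow_toL2 (F : cutoffFun E) (n : ℕ) :
    (smearedFieldEnd p α φ ^ n) ⟨toL2 p α F, F, rfl⟩ =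
      ⟨toL2 p α ((fieldLin p α φ ^ n) F), (fieldLin p α φ ^ n) F, rfl⟩ := by
  induction n with
  | zero => rfl
  | succ n ih =>
    simp only [pow_succ', Module.End.mul_apply, ih, smearedFieldEnd_toL2]

theorem smearedFieldOp_toL2 (F : cutoffFun E) :
    smearedFieldOp p α φ ⟨toL2 p α F, F, rfl⟩ = toL2 p α (fieldLin p α φ F) :=
  congrArg Subtype.val (smearedFieldEnd_toL2 p α φ F)

theorem graph_smearedFieldOp : (smearedFieldOp p α φ).graph =
    LinearMap.range ((toL2 p α).prod (toL2 p α ∘ₗ fieldLin p α φ)) := by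
  ext ⟨x, y⟩
  rw [LinearPMap.mem_graph_iff]
  constructor
  · rintro ⟨⟨_, F, rfl⟩, rfl, rfl⟩
    exact ⟨F, Prod.ext rfl (smearedFieldOp_toL2 p α φ F).symm⟩
  · rintro ⟨F, hF⟩
    obtain ⟨rfl, rfl⟩ := Prod.mk.inj hF
    exact ⟨⟨toL2 p α F, F, rfl⟩, rfl, smearedFieldOp_toL2 p α φ F⟩

theorem inner_fieldLin (F G : cutoffFun E) :
    inner ℂ (toL2 p α (fieldLin p α φ F)) (toL2 p α G) =
      inner ℂ (toL2 p α F) (toL2 p α (fieldLin p α φ G)) := by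
  simp only [fieldLin_apply, map_smul, map_sub, inner_smul_left, inner_smul_right,
    inner_sub_left, inner_sub_right, inner_raiseLin, inner_lowerLin, one_div, Complex.inv_I,
    map_neg, Complex.conj_I]
  ring

theorem isFormalAdjoint_smearedFieldOp :
    (smearedFieldOp p α φ).IsFormalAdjoint (smearedFieldOp p α φ) := by
  rintro ⟨_, F, rfl⟩ ⟨_, G, rfl⟩
  rw [smearedFieldOp_toL2, smearedFieldOp_toL2]
  exact inner_fieldLin p α φ F G

variable {p α φ}

theorem VanishesAbove.fieldLin {m : ℕ} {F : cutoffFun E} (hF : VanishesAbove m F) :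
    VanishesAbove (m + 1) (fieldLin p α φ F) := by
  intro η hη
  by_contra! hlt
  have hraise : (Pascal.raiseLin p φ F).1 η = 0 :=
    not_not.1 fun h => hlt.not_ge (hF.raiseLin p φ η h)
  have hlower : (Pascal.lowerLin p α φ F).1 η = 0 :=
    not_not.1 fun h => hlt.not_ge ((hF.lowerLin p α φ η h).trans m.le_succ)
  exact hη (by simp [fieldLin_apply, hraise, hlower])

theorem fieldLin_weight (w : ℕ → ℝ) (F : cutoffFun E) :
    fieldLin p α φ (weight w F) = (1 / Complex.I) •
      (raiseLin p φ (weight w F) - weight (fun n => w (n + 1)) (lowerLin p α φ F)) := by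
  rw [fieldLin_apply, lowerLin_weight]

theorem fieldLin_weight_sub (w : ℕ → ℝ) (F : cutoffFun E) :
    fieldLin p α φ (weight w F) - weight w (fieldLin p α φ F) = (1 / Complex.I) •
      (raiseLin p φ (weight (fun n => w n - w (n + 1)) F) +
        weight (fun n => w n - w (n + 1)) (lowerLin p α φ F)) := by
  simp only [fieldLin_apply, lowerLin_weight, map_smul, map_sub, weight_raiseLin, weight_sub]
  module

variable {D c : ℝ} {w : ℕ → ℝ}

theorem norm_fieldLin_weight_le (hD0 : 0 ≤ D) (hD : ∀ x, ‖φ.1 x‖ ≤ D) {m : ℕ}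
    (hw1 : ∀ n, |w n| ≤ 1) (hw0 : ∀ n, m < n → w n = 0) (F : cutoffFun E) :
    ‖toL2 p α (fieldLin p α φ (weight w F))‖ ≤
      2 * D * (α.real Set.univ + 1) * (m + 1) * ‖toL2 p α F‖ := by
  have hw : ∀ n k, n ≤ k →
      |w k| * (α.real Set.univ + n + 1) ≤ (α.real Set.univ + 1) * (m + 1) := by
    intro n k hnk
    rcases le_or_gt k m with hk | hk
    · have hnm : (n : ℝ) ≤ m := by exact_mod_cast hnk.trans hk
      have ham : 0 ≤ α.real Set.univ * m := by positivity
      refine (mul_le_of_le_one_left (by positivity) (hw1 k)).trans ?_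
      linarith
    · rw [hw0 k hk, abs_zero, zero_mul]
      positivity
  have hraise := norm_raiseLin_weight_le p α hD0 hD (fun n => hw n n le_rfl) F
  have hlower := norm_weight_lowerLin_le p α hD0 hD (fun n => hw n (n + 1) n.le_succ) F
  rw [fieldLin_weight, map_smul, norm_smul, map_sub, one_div, norm_inv, Complex.norm_I, inv_one,
    one_mul]
  linarith [norm_sub_le (toL2 p α (raiseLin p φ (weight w F)))
    (toL2 p α (weight (fun n => w (n + 1)) (lowerLin p α φ F)))]

theorem norm_fieldLin_weight_sub_le (hD0 : 0 ≤ D) (hD : ∀ x, ‖φ.1 x‖ ≤ D)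
    (hw : ∀ n, |w n - w (n + 1)| * (α.real Set.univ + n + 1) ≤ c) (F : cutoffFun E) :
    ‖toL2 p α (fieldLin p α φ (weight w F) - weight w (fieldLin p α φ F))‖ ≤
      2 * D * c * ‖toL2 p α F‖ := by
  have hraise := norm_raiseLin_weight_le p α hD0 hD hw F
  have hlower := norm_weight_lowerLin_le p α hD0 hD hw F
  rw [fieldLin_weight_sub, map_smul, norm_smul, map_add, one_div, norm_inv, Complex.norm_I,
    inv_one, one_mul]
  linarith [norm_add_le (toL2 p α (raiseLin p φ (weight (fun n => w n - w (n + 1)) F)))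
    (toL2 p α (weight (fun n => w n - w (n + 1)) (lowerLin p α φ F)))]

theorem VanishesAbove.norm_fieldLin_le (hD0 : 0 ≤ D) (hD : ∀ x, ‖φ.1 x‖ ≤ D) {m : ℕ}
    {F : cutoffFun E} (hF : VanishesAbove m F) :
    ‖toL2 p α (Pascal.fieldLin p α φ F)‖ ≤
      2 * D * (α.real Set.univ + 1) * (m + 1) * ‖toL2 p α F‖ := by
  have h := norm_fieldLin_weight_le (p := p) (α := α) hD0 hD (m := m)
    (w := fun n => if n ≤ m then 1 else 0) (fun n => by split_ifs <;> simp)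
    (fun n hn => if_neg hn.not_ge) F
  rwa [hF.weight_eq_self fun n hn => if_pos hn] at h

theorem VanishesAbove.fieldLin_pow {m : ℕ} {F : cutoffFun E} (hF : VanishesAbove m F) (n : ℕ) :
    VanishesAbove (m + n) ((Pascal.fieldLin p α φ ^ n) F) := by
  induction n with
  | zero => exact hF
  | succ n ih =>
    rw [pow_succ', Module.End.mul_apply]
    exact ih.fieldLin

theorem VanishesAbove.norm_fieldLin_pow_le (hD0 : 0 ≤ D) (hD : ∀ x, ‖φ.1 x‖ ≤ D) {m : ℕ}
    {F : cutoffFun E} (hF : VanishesAbove m F) (n : ℕ) :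
    ‖toL2 p α ((Pascal.fieldLin p α φ ^ n) F)‖ ≤
      (2 * D * (α.real Set.univ + 1)) ^ n * (m + 1).ascFactorial n * ‖toL2 p α F‖ := by
  induction n with
  | zero => simp
  | succ n ih =>
    rw [pow_succ' (Pascal.fieldLin p α φ), Module.End.mul_apply]
    calc _ ≤ 2 * D * (α.real Set.univ + 1) * ((m + n : ℕ) + 1) *
          ‖toL2 p α ((Pascal.fieldLin p α φ ^ n) F)‖ := (hF.fieldLin_pow n).norm_fieldLin_le hD0 hD
      _ ≤ 2 * D * (α.real Set.univ + 1) * ((m + n : ℕ) + 1) *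
          ((2 * D * (α.real Set.univ + 1)) ^ n * (m + 1).ascFactorial n * ‖toL2 p α F‖) := by
        gcongr
      _ = _ := by
        rw [Nat.ascFactorial_succ, pow_succ]
        push_cast
        ring

variable (p α φ)

theorem exists_summable_smearedFieldEnd_pow (f : dom p α) : ∃ ε : ℝ, 0 < ε ∧
    Summable fun n : ℕ => ε ^ n / n.factorial * ‖(smearedFieldEnd p α φ ^ n) f‖ := by
  obtain ⟨_, F, rfl⟩ := f
  obtain ⟨m, hF⟩ := exists_vanishesAbove F
  obtain ⟨D, hD0, hD⟩ := exists_nonneg_bound φ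
  refine exists_summable_pow_div_factorial_mul (fun n => norm_nonneg _)
    (K := 2 * D * (α.real Set.univ + 1)) (c := ‖toL2 p α F‖) (m := m) (by positivity) fun n => ?_
  rw [smearedFieldEnd_pow_toL2]
  exact hF.norm_fieldLin_pow_le hD0 hD n

theorem isFriedrichsMollifier_weight_ramp :
    IsFriedrichsMollifier Filter.atTop (toL2 p α) (fieldLin p α φ) fun N => weight (ramp N) := by
  obtain ⟨D, hD0, hD⟩ := exists_nonneg_bound φ
  have heventually : ∀ F : cutoffFun E, ∀ᶠ N in Filter.atTop, weight (ramp N) F = F := fun F => by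
    obtain ⟨m, hF⟩ := exists_vanishesAbove F
    filter_upwards [Filter.eventually_ge_atTop m] with N hN
    exact hF.weight_eq_self fun n hn => ramp_eq_one (by lia)
  exact {
    symmetric := fun N => inner_weight p α (ramp N)
    bounded := ⟨1, fun N => norm_weight_le p α (abs_ramp_le N)⟩
    comp_bounded := fun N => ⟨_, norm_fieldLin_weight_le hD0 hD (m := 2 * (N + 1)) (abs_ramp_le N)
      fun n hn => ramp_eq_zero hn.le⟩
    commutator_bounded := ⟨_, fun N => norm_fieldLin_weight_sub_le hD0 hD
      (abs_ramp_sub_mul_le measureReal_nonneg N)⟩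
    tendsto := fun F => tendsto_nhds_of_eventually_eq <| (heventually F).mono fun N h => by rw [h]
    tendsto_apply := fun F =>
      tendsto_nhds_of_eventually_eq <| (heventually F).mono fun N h => by rw [h] }

end SmearedField

section ConstantField

/-- The constant function `ξ` on `E`. -/
def const (E : Type*) [MeasurableSpace E] (ξ : ℂ) : BddMeasurable E :=
  ⟨fun _ => ξ, measurable_const, ‖ξ‖, fun _ => le_rfl⟩

variable (p : Set.Ioo (0 : ℝ) 1) (α : Measure E) [IsFiniteMeasure α]

theorem raiseLin_const [StandardBorelSpace E] (ξ : ℂ) :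
    raiseLin p (const E ξ) = ξ • raiseLin p (one E) := by
  ext F η
  change raiseFun p (fun _ => ξ) F.1 η = ξ * raiseFun p (fun _ => 1) F.1 η
  simp only [raiseFun, integral_const_mul, one_mul]
  ring

theorem lowerLin_const (ξ : ℂ) : lowerLin p α (const E ξ) = conj ξ • lowerLin p α (one E) := by
  ext F η
  change lowerFun p α (fun _ => ξ) F.1 η = conj ξ * lowerFun p α (fun _ => 1) F.1 η
  simp only [lowerFun, integral_const_mul, map_one, one_mul]
  ring

variable [StandardBorelSpace E]

theorem smearedFieldEnd_const (ξ : ℂ) : smearedFieldEnd p α (const E ξ) = fieldEnd p α ξ := by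
  refine LinearMap.ext ?_
  rintro ⟨_, F, rfl⟩
  refine Subtype.ext ?_
  simp only [smearedFieldEnd, fieldEnd, kPlus, kMinus, LinearMap.smul_apply, LinearMap.sub_apply,
    descend_apply, raiseLin_const, lowerLin_const, map_smul, Submodule.coe_smul,
    AddSubgroupClass.coe_sub]

theorem smearedFieldOp_const (ξ : ℂ) : smearedFieldOp p α (const E ξ) = fieldOp p α ξ := by
  rw [smearedFieldOp, smearedFieldEnd_const, fieldOp]

end ConstantField

end Pascal

end

theorem lemma4p2_general {E : Type*} [MeasurableSpace E] [StandardBorelSpace E]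
    (p : Set.Ioo (0 : ℝ) 1) (α : Measure E) [IsFiniteMeasure α] (φ : Pascal.BddMeasurable E) :
    (Pascal.smearedFieldOp p α φ).IsClosable ∧
      IsSelfAdjoint (Pascal.smearedFieldOp p α φ).closure ∧
      ∀ f : Pascal.dom p α, ∃ ε : ℝ, 0 < ε ∧
        Summable fun n : ℕ => ε ^ n / n.factorial * ‖(Pascal.smearedFieldEnd p α φ ^ n) f‖ :=
  have hdense := Pascal.dense_dom p α
  have hsymm := Pascal.isFormalAdjoint_smearedFieldOp p α φ
  ⟨isClosable_of_isFormalAdjoint_self hdense hsymm,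
    (Pascal.isFriedrichsMollifier_weight_ramp p α φ).isSelfAdjoint_closure hdense hsymm
      (Pascal.graph_smearedFieldOp p α φ),
    Pascal.exists_summable_smearedFieldEnd_pow p α φ⟩

theorem lemma4p2 {E : Type*} [MeasurableSpace E] [StandardBorelSpace E]
    (p : Set.Ioo (0 : ℝ) 1) (α : MeasureTheory.Measure E) [MeasureTheory.IsFiniteMeasure α]
    (ξ : ℂ) :
    (Pascal.fieldOp p α ξ).IsClosable ∧
      IsSelfAdjoint (Pascal.fieldOp p α ξ).closure ∧
      ∀ f : Pascal.dom p α, ∃ ε : ℝ, 0 < ε ∧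
        Summable fun n : ℕ => ε ^ n / n.factorial * ‖(Pascal.fieldEnd p α ξ ^ n) f‖ := by
  rw [← Pascal.smearedFieldOp_const, ← Pascal.smearedFieldEnd_const]
  exact lemma4p2_general p α (Pascal.const E ξ)
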